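/- Let $N\ge 1$ be an integer and $p>1$. For $y\in\mathbb R^N$, $s\in\mathbb R$, $\rho,\tau>0$ let $K_\rho(y)\subset\mathbb R^N$ be the (open) cube of edge $2\rho$ centred at $y$ and $(y,s)+Q_{\rho,\tau}=K_\rho(y)\times(s-\tau,s]$. Let $r_+=\max\{r,0\}$ and $r_-=\max\{-r,0\}$, let $D$ denote the weak gradient in the space variables, and let $\Subset$ denote compact containment. A function $\mathcal A(R,T,\rho,\tau)>0$, defined for $0<\rho<R$ and $0<\tau<T$, is called a homogeneous quantity if under the relations $\rho=\sigma_1R$, $\tau=\sigma_2T$, $T=R^p$ it becomes a function of $\sigma_1,\sigma_2\in(0,1)$ only. Let $E\subset\mathbb R^N\times\mathbb R$ be open and let $\mathcal A_0$ be a homogeneous quantity. A measurable function $u:E\to\mathbb R$ belongs to the generalized class $\mathfrak A_p^{\pm}(E,\mathcal A_0)$ if, for every cylinder $(y,s)+Q_{R,T}\Subset E$, $$u\in L^\infty\big(s-T,s;L^p(K_R(y))\big)\cap L^p\big(s-T,s;W^{1,p}(K_R(y))\big)$$ and, for all $0<\rho<R$, $0<\tau<T$ and $k\in\mathbb R$,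 with $\mathcal A_0=\mathcal A_0(R,T,\rho,\tau)$, $$\operatorname*{ess\,sup}_{s-\tau<t<s}\int_{K_\rho(y)}(u-k)_\pm^p(\cdot,t)\,dx+\iint_{(y,s)+Q_{\rho,\tau}}|D(u-k)_\pm|^p\,dx\,dt\le\Big[\frac{\mathcal A_0}{(R-\rho)^p}+\frac{\mathcal A_0}{T-\tau}\Big]\iint_{(y,s)+Q_{R,T}}(u-k)_\pm^p\,dx\,dt .$$ For a constant $\gamma>0$, the parabolic De Giorgi class $\mathfrak A_p^\pm(E,\gamma)$ is the class obtained for $\mathcal A_0\equiv\gamma$. **Theorem.** (a) For every $\gamma>0$ there is a homogeneous quantity $\mathcal A$, determined by $\gamma,p,N$ only, such that for each choice of the sign $\pm$, every open $E\subset\mathbb R^N\times\mathbb R$ and every $u\in\mathfrak A_p^\pm(E,\gamma)$: $$\operatorname*{ess\,sup}_{(y,s)+Q_{\rho,\tau}}(u-k)_\pm\le\frac{\mathcal A(R,T,\rho,\tau)}{(R-\rho)^N(T-\tau)}\iint_{(y,s)+Q_{R,T}}(u-k)_\pm\,dx\,dt$$ for every cylinder $(y,s)+Q_{R,T}\subset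 E$, all $0<\rho<R$, $0<\tau<T$ and all $k\in\mathbb R$ (the right-hand side may be $+\infty$). In particular, $u$ is essentially bounded from above (sign $+$), respectively from below (sign $-$), on every compact subset of $E$. (b) The same conclusion holds for the generalized classes: for every homogeneous quantity $\mathcal A_0$ there is a homogeneous quantity $\mathcal A$, determined by $\mathcal A_0,p,N$ only, such that the statements of (a) hold for each sign, every open $E$ and every $u\in\mathfrak A_p^\pm(E,\mathcal A_0)$. -/

import Mathlib

open MeasureTheory Set

noncomputable section

namespace ParabolicDeGiorgi

/-- Euclidean space `ℝ^N`. -/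
abbrev Space (N : ℕ) : Type := EuclideanSpace ℝ (Fin N)

/-- The open cube of edge `2ρ` centred at `y`. -/
def cube {N : ℕ} (y : Space N) (ρ : ℝ) : Set (Space N) :=
  {x | ∀ i, |x i - y i| < ρ}

/-- The cylinder `(y,s) + Q_{ρ,τ} = K_ρ(y) × (s - τ, s]`. -/
def parabolicCylinder {N : ℕ} (y : Space N) (s ρ τ : ℝ) : Set (Space N × ℝ) :=
  cube y ρ ×ˢ Ioc (s - τ) s

/-- The sign `±` selecting one of the two truncations. -/
inductive Side : Type
  | plus
  | minus

/-- `trunc ± a k` is `(a - k)_±`; here `r_+ = max r 0` and `r_- = max (-r) 0`. -/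
def trunc : Side → ℝ → ℝ → ℝ
  | Side.plus, a, k => max (a - k) 0
  | Side.minus, a, k => max (-(a - k)) 0

/-- `g` is the weak (distributional) gradient of `f` on the open set `U ⊆ ℝ^N`. -/
def IsWeakGradient {N : ℕ} (U : Set (Space N)) (f : Space N → ℝ) (g : Space N → Space N) : Prop :=
  LocallyIntegrableOn f U ∧ LocallyIntegrableOn g U ∧
    ∀ φ : Space N → ℝ, ContDiff ℝ (⊤ : ℕ∞) φ → HasCompactSupport φ → tsupport φ ⊆ U →
      ∀ i : Fin N,
        ∫ x in U, f x * fderiv ℝ φ x (EuclideanSpace.single i 1) = - ∫ x in U, g x i * φ x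

/-- `g` is the weak gradient of `v` in the space variables on `(y,s) + Q_{ρ,τ}`: it is measurable
in `(x,t)`, and for almost every `t` the slice `g(·,t)` is the weak gradient of `v(·,t)` on
`K_ρ(y)`. -/
def IsSpatialGradient {N : ℕ} (y : Space N) (s ρ τ : ℝ) (v : Space N × ℝ → ℝ)
    (g : Space N × ℝ → Space N) : Prop :=
  AEStronglyMeasurable g (volume.restrict (parabolicCylinder y s ρ τ)) ∧
    ∀ᵐ t ∂(volume.restrict (Ioo (s - τ) s)),
      IsWeakGradient (cube y ρ) (fun x => v (x, t)) (fun x => g (x, t))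

/-- `v ∈ L^∞(s-T, s; L^p(K_R(y))) ∩ L^p(s-T, s; W^{1,p}(K_R(y)))`. -/
def InParabolicSpace {N : ℕ} (p : ℝ) (y : Space N) (s R T : ℝ) (v : Space N × ℝ → ℝ) : Prop :=
  essSup (fun t => ∫⁻ x in cube y R, ‖v (x, t)‖ₑ ^ p) (volume.restrict (Ioo (s - T) s)) < ⊤ ∧
    MemLp v (ENNReal.ofReal p) (volume.restrict (parabolicCylinder y s R T)) ∧
    ∃ g : Space N × ℝ → Space N,
      IsSpatialGradient y s R T v g ∧
        MemLp g (ENNReal.ofReal p) (volume.restrict (parabolicCylinder y s R T))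

/-- The energy inequality with constant `c`, for the pair of cylinders `(y,s) + Q_{ρ,τ}` and
`(y,s) + Q_{R,T}` and the truncation `(u - k)_±`. Weak gradients are unique up to null sets, so `g`
is `D(u - k)_±`. -/
def EnergyInequality {N : ℕ} (sgn : Side) (p c : ℝ) (u : Space N × ℝ → ℝ) (y : Space N)
    (s R T ρ τ k : ℝ) : Prop :=
  ∃ g : Space N × ℝ → Space N,
    IsSpatialGradient y s ρ τ (fun z => trunc sgn (u z) k) g ∧
      essSup (fun t => ∫⁻ x in cube y ρ, ENNReal.ofReal (trunc sgn (u (x, t)) k) ^ p)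
          (volume.restrict (Ioo (s - τ) s))
        + ∫⁻ z in parabolicCylinder y s ρ τ, ‖g z‖ₑ ^ p
      ≤ ENNReal.ofReal (c / (R - ρ) ^ p + c / (T - τ)) *
          ∫⁻ z in parabolicCylinder y s R T, ENNReal.ofReal (trunc sgn (u z) k) ^ p

/-- `u` belongs to the generalized class `𝔄_p^±` on `E`, where the constant in the energy
inequality is the function `A (R, T, ρ, τ)`. As a cylinder is bounded, `(y,s) + Q_{R,T} ⋐ E` means
that its closure lies in `E`. -/
def InGeneralizedClass {N : ℕ} (sgn : Side) (p : ℝ) (A : ℝ → ℝ → ℝ → ℝ → ℝ)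
    (E : Set (Space N × ℝ)) (u : Space N × ℝ → ℝ) : Prop :=
  AEMeasurable u (volume.restrict E) ∧
    ∀ (y : Space N) (s R T : ℝ), 0 < R → 0 < T → closure (parabolicCylinder y s R T) ⊆ E →
      InParabolicSpace p y s R T u ∧
        ∀ ρ τ k : ℝ, 0 < ρ → ρ < R → 0 < τ → τ < T →
          EnergyInequality sgn p (A R T ρ τ) u y s R T ρ τ k

/-- `u` belongs to the parabolic De Giorgi class `𝔄_p^±(E, γ)`. -/
def InDeGiorgiClass {N : ℕ} (sgn : Side) (p γ : ℝ) (E : Set (Space N × ℝ))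
    (u : Space N × ℝ → ℝ) : Prop :=
  InGeneralizedClass sgn p (fun _ _ _ _ => γ) E u

/-- `A (R, T, ρ, τ)` is a positive homogeneous quantity: if `ρ = σ₁ R`, `τ = σ₂ T` and `T = R ^ p`,
then it is a function of `σ₁` and `σ₂` only. -/
def IsHomogeneousQuantity (p : ℝ) (A : ℝ → ℝ → ℝ → ℝ → ℝ) : Prop :=
  (∀ R T ρ τ : ℝ, 0 < ρ → ρ < R → 0 < τ → τ < T → 0 < A R T ρ τ) ∧
    ∃ f : ℝ → ℝ → ℝ, ∀ R σ₁ σ₂ : ℝ, 0 < R → 0 < σ₁ → σ₁ < 1 → 0 < σ₂ → σ₂ < 1 →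
      A R (R ^ p) (σ₁ * R) (σ₂ * R ^ p) = f σ₁ σ₂

/-- The supremum estimate with the quantity `A`, for all cylinders `(y,s) + Q_{R,T} ⊆ E` and all
levels `k`. -/
def SupEstimate {N : ℕ} (sgn : Side) (A : ℝ → ℝ → ℝ → ℝ → ℝ) (E : Set (Space N × ℝ))
    (u : Space N × ℝ → ℝ) : Prop :=
  ∀ (y : Space N) (s R T ρ τ k : ℝ), 0 < ρ → ρ < R → 0 < τ → τ < T →
    parabolicCylinder y s R T ⊆ E →
      essSup (fun z => ENNReal.ofReal (trunc sgn (u z) k)) (volume.restrict (parabolicCylinder y s ρ τ))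
        ≤ ENNReal.ofReal (A R T ρ τ / ((R - ρ) ^ N * (T - τ))) *
            ∫⁻ z in parabolicCylinder y s R T, ENNReal.ofReal (trunc sgn (u z) k)

/-- `u` is essentially bounded from above (sign `+`), respectively from below (sign `-`), on every
compact subset of `E`. -/
def LocallyBoundedSide {N : ℕ} (sgn : Side) (E : Set (Space N × ℝ)) (u : Space N × ℝ → ℝ) : Prop :=
  ∀ K : Set (Space N × ℝ), IsCompact K → K ⊆ E →
    ∃ M : ℝ, ∀ᵐ z ∂(volume.restrict K), trunc sgn (u z) 0 ≤ M

end ParabolicDeGiorgi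

end

open MeasureTheory Set

noncomputable section

namespace ParabolicDeGiorgi

/-! The argument is De Giorgi's iteration, but without a Sobolev embedding. A function with a weak
gradient is, almost everywhere, an integral of that gradient along segments, so its translates by
`ζ` differ from it in `L^p` by at most `|ζ|` times the norm of the gradient. Averaging over `ζ` in a
small cube gives a Poincaré-type inequality for functions that vanish on most of a cube
(`IsWeakGradient.lintegral_cube_le`): the `L^p` mass is bounded by a small multiple of the gradient
term plus the mass times the relative measure of the set where the function is nonzero. The energy
inequality controls both the gradient and the mass of each time slice, and Chebyshev's inequality
makes the measure small once the level is raised (lowered, for the sign minus).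

Hence smallness of the `p`-mass on a cylinder of radius `r` and height `r^p` reproduces itself with
radius `r/4` and level increment halved (`exists_powerMass_step`). Iterating around every centre,
the mean of `(u - k')_±^p`, with `k'` the level shifted by `2δ`, tends to zero on shrinking
cylinders. An average over centres then shows that this truncation vanishes almost everywhere. This
bounds the `p`-th power of the supremum by the integral of `(u - k)_±^p`.

To reach the first power, one factor is kept in the integral and `p - 1` factors are replaced by the
supremum over a slightly larger cylinder; a chain of cylinders absorbs these powers
(`le_of_rpow_le_mul_rpow_succ`).

The iteration uses only cylinders with ratios `1/2` and `(1/2)^p`. On these a homogeneous quantity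
takes a single value, so the generalized class behaves like the class with a constant, and (a) is a
case of (b). -/

/-! ### Geometry of cubes and cylinders. -/

theorem cube_eq_preimage {N : ℕ} (y : Space N) (ρ : ℝ) :
    cube y ρ = (fun x : Space N => (WithLp.ofLp x : Fin N → ℝ)) ⁻¹'
      (Set.pi univ fun i => Ioo (y i - ρ) (y i + ρ)) := by
  ext x
  simp only [cube, mem_ofPred_eq, mem_preimage, Set.mem_pi, mem_univ, true_implies, mem_Ioo, abs_lt]
  exact forall_congr' fun i => ⟨fun h => ⟨by linarith [h.1], by linarith [h.2]⟩,
    fun h => ⟨by linarith [h.1], by linarith [h.2]⟩⟩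

theorem isOpen_cube {N : ℕ} (y : Space N) (ρ : ℝ) : IsOpen (cube y ρ) := by
  rw [cube_eq_preimage]
  exact (isOpen_set_pi finite_univ fun _ _ => isOpen_Ioo).preimage (PiLp.continuous_ofLp 2 _)

theorem measurableSet_cube {N : ℕ} (y : Space N) (ρ : ℝ) : MeasurableSet (cube y ρ) :=
  (isOpen_cube y ρ).measurableSet

theorem volume_cube {N : ℕ} (y : Space N) {ρ : ℝ} :
    volume (cube y ρ) = ENNReal.ofReal (2 * ρ) ^ N := by
  rw [cube_eq_preimage]
  have h := (PiLp.volume_preserving_ofLp (Fin N)).measure_preimage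
    (s := Set.pi univ fun i => Ioo (y i - ρ) (y i + ρ))
    (MeasurableSet.univ_pi fun _ => measurableSet_Ioo).nullMeasurableSet
  refine h.trans ?_
  rw [Real.volume_pi_Ioo]
  simp only [add_sub_sub_cancel, Finset.prod_const, Finset.card_univ, Fintype.card_fin, two_mul]

theorem cube_subset_cube {N : ℕ} {y y' : Space N} {ρ ρ' : ℝ} (h : ∀ i, |y i - y' i| + ρ ≤ ρ') :
    cube y ρ ⊆ cube y' ρ' := fun x hx i => by
  have h1 := h i
  have h2 : |x i - y i| < ρ := hx i
  have h3 := abs_sub_le (x i) (y i) (y' i)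
  linarith

theorem measurableSet_parabolicCylinder {N : ℕ} (y : Space N) (s ρ τ : ℝ) :
    MeasurableSet (parabolicCylinder y s ρ τ) :=
  (measurableSet_cube y ρ).prod measurableSet_Ioc

theorem volume_parabolicCylinder {N : ℕ} (y : Space N) (s ρ τ : ℝ) :
    volume (parabolicCylinder y s ρ τ) = ENNReal.ofReal (2 * ρ) ^ N * ENNReal.ofReal τ := by
  rw [parabolicCylinder, Measure.volume_eq_prod, Measure.prod_prod, volume_cube, Real.volume_Ioc,
    sub_sub_cancel]

/-- The top face is a null set. This reconciles the half-open cylinders with the open time intervals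
of the slice conditions and opens the way to Tonelli. -/
theorem restrict_parabolicCylinder {N : ℕ} (y : Space N) (s ρ τ : ℝ) :
    (volume : Measure (Space N × ℝ)).restrict (parabolicCylinder y s ρ τ) =
      (volume.restrict (cube y ρ)).prod (volume.restrict (Ioo (s - τ) s)) := by
  rw [Measure.restrict_congr_set (Ioo_ae_eq_Ioc (μ := (volume : Measure ℝ))), Measure.prod_restrict]
  rfl

theorem isCompact_closedCube {N : ℕ} (y : Space N) (ρ : ℝ) :
    IsCompact {x : Space N | ∀ i, |x i - y i| ≤ ρ} := by
  have : {x : Space N | ∀ i, |x i - y i| ≤ ρ} =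
      (EuclideanSpace.equiv (Fin N) ℝ).toHomeomorph ⁻¹'
        (Set.pi univ fun i => Icc (y i - ρ) (y i + ρ)) := by
    ext x
    simp only [mem_ofPred_eq, mem_preimage, Set.mem_pi, mem_univ, true_implies, mem_Icc, abs_le]
    refine forall_congr' fun i => ?_
    change _ ↔ y i - ρ ≤ x i ∧ x i ≤ y i + ρ
    constructor <;> rintro ⟨h1, h2⟩ <;> constructor <;> linarith
  rw [this, Homeomorph.isCompact_preimage]
  exact isCompact_univ_pi fun _ => isCompact_Icc

theorem closure_parabolicCylinder_subset {N : ℕ} (y : Space N) (s ρ τ : ℝ) :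
    closure (parabolicCylinder y s ρ τ) ⊆
      {x : Space N | ∀ i, |x i - y i| ≤ ρ} ×ˢ Icc (s - τ) s :=
  closure_minimal (prod_mono (fun _ hx i => (hx i).le) Ioc_subset_Icc_self)
    ((isCompact_closedCube y ρ).isClosed.prod isClosed_Icc)

theorem parabolicCylinder_subset {N : ℕ} {y y' : Space N} {s s' ρ ρ' τ τ' : ℝ}
    (h : ∀ i, |y i - y' i| + ρ ≤ ρ') (h1 : s' - τ' ≤ s - τ) (h2 : s ≤ s') :
    parabolicCylinder y s ρ τ ⊆ parabolicCylinder y' s' ρ' τ' :=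
  prod_mono (cube_subset_cube h) (Ioc_subset_Ioc h1 h2)

/-- Cylinders contain their top face, so the final times may coincide; only the lateral and bottom
faces need a gap. This passes from cylinders contained in `E` to cylinders compactly contained in
it. -/
theorem closure_parabolicCylinder_subset_parabolicCylinder {N : ℕ} {y y' : Space N}
    {s s' ρ ρ' τ τ' : ℝ} (h : ∀ i, |y i - y' i| + ρ < ρ') (h1 : s' - τ' < s - τ) (h2 : s ≤ s') :
    closure (parabolicCylinder y s ρ τ) ⊆ parabolicCylinder y' s' ρ' τ' := by
  refine (closure_parabolicCylinder_subset y s ρ τ).trans (prod_mono (fun x hx i => ?_)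
    fun t ht => ⟨h1.trans_le ht.1, ht.2.trans h2⟩)
  have h1 := h i
  have h2 : |x i - y i| ≤ ρ := hx i
  have h3 := abs_sub_le (x i) (y i) (y' i)
  linarith

/-! ### Truncations, treated uniformly in the sign. -/

/-- The level reached from `k` by raising (sign `+`) or lowering (sign `-`) it by `δ`. -/
def shiftLevel : Side → ℝ → ℝ → ℝ
  | Side.plus, k, δ => k + δ
  | Side.minus, k, δ => k - δ

theorem shiftLevel_shiftLevel (sgn : Side) (k δ δ' : ℝ) :
    shiftLevel sgn (shiftLevel sgn k δ) δ' = shiftLevel sgn k (δ + δ') := by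
  cases sgn <;> simp only [shiftLevel] <;> ring

theorem trunc_nonneg (sgn : Side) (a k : ℝ) : 0 ≤ trunc sgn a k := by
  cases sgn <;> simp [trunc]

theorem trunc_shiftLevel (sgn : Side) (a k : ℝ) {δ : ℝ} (hδ : 0 ≤ δ) :
    trunc sgn a (shiftLevel sgn k δ) = max (trunc sgn a k - δ) 0 := by
  cases sgn <;> simp only [shiftLevel, trunc] <;> grind

theorem trunc_le (sgn : Side) (a k : ℝ) : trunc sgn a k ≤ |a| + |k| := by
  cases sgn <;> simp only [trunc] <;> grind

theorem measurable_trunc (sgn : Side) (k : ℝ) : Measurable fun a => trunc sgn a k := by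
  cases sgn <;> simp only [trunc] <;> fun_prop

/-! ### Weak gradients and translations. -/

/-- Test functions supported in `K` do not see the cut-off by `K`, which turns local integrability
into integrability on the whole space; translation invariance and Fubini then apply freely. General
directions follow from the coordinate ones by linearity. -/
theorem IsWeakGradient.integral_mul_fderiv_eq {N : ℕ} {U K : Set (Space N)} {f : Space N → ℝ}
    {g : Space N → Space N} (hw : IsWeakGradient U f g) (hK : IsCompact K) (hKU : K ⊆ U)
    {φ : Space N → ℝ} (hφ : ContDiff ℝ (⊤ : ℕ∞) φ) (hφK : tsupport φ ⊆ K) (ζ : Space N) :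
    ∫ x, K.indicator f x * fderiv ℝ φ x ζ = -∫ x, inner ℝ (K.indicator g x) ζ * φ x := by
  obtain ⟨hf, hg, hw⟩ := hw
  have hc : HasCompactSupport φ := hK.of_isClosed_subset (isClosed_tsupport φ) hφK
  have hF : Integrable (K.indicator f) :=
    (integrable_indicator_iff hK.measurableSet).2 ((hf.mono_set hKU).integrableOn_isCompact hK)
  have hG : Integrable (K.indicator g) :=
    (integrable_indicator_iff hK.measurableSet).2 ((hg.mono_set hKU).integrableOn_isCompact hK)
  have hDcont : ∀ v : Space N, Continuous fun x => fderiv ℝ φ x v := fun v =>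
    (hφ.continuous_fderiv (by simp)).clm_apply continuous_const
  have hDsupp : ∀ v : Space N, ∀ x ∉ K, fderiv ℝ φ x v = 0 := fun v x hx => by
    rw [fderiv_of_notMem_tsupport (𝕜 := ℝ) (fun h => hx (hφK h))]; rfl
  have hφsupp : ∀ x ∉ K, φ x = 0 := fun x hx => image_eq_zero_of_notMem_tsupport (fun h => hx (hφK h))
  have hFD : ∀ v : Space N, Integrable fun x => K.indicator f x * fderiv ℝ φ x v := fun v => by
    obtain ⟨C, hC⟩ := (hc.fderiv_apply ℝ v).exists_bound_of_continuous (hDcont v)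
    exact hF.mul_bdd (hDcont v).aestronglyMeasurable (.of_forall hC)
  have hGφ : ∀ i, Integrable fun x => K.indicator g x i * φ x := fun i => by
    obtain ⟨C, hC⟩ := hc.exists_bound_of_continuous hφ.continuous
    exact ((EuclideanSpace.proj (𝕜 := ℝ) i).integrable_comp hG).mul_bdd
      hφ.continuous.aestronglyMeasurable (.of_forall hC)
  have key : ∀ i, ∫ x, K.indicator f x * fderiv ℝ φ x (EuclideanSpace.single i 1) =
      -∫ x, K.indicator g x i * φ x := fun i => by
    have h := hw φ hφ hc (hφK.trans hKU) i
    rw [setIntegral_eq_integral_of_forall_compl_eq_zero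
        (fun x hx => by rw [hDsupp _ x (fun h => hx (hKU h)), mul_zero]),
      setIntegral_eq_integral_of_forall_compl_eq_zero
        (fun x hx => by rw [hφsupp x (fun h => hx (hKU h)), mul_zero])] at h
    refine (integral_congr_ae (.of_forall fun x => ?_)).trans
      (h.trans (congrArg Neg.neg (integral_congr_ae (.of_forall fun x => ?_))))
    all_goals
      by_cases hx : x ∈ K
      · simp [indicator_of_mem hx]
      · simp [hDsupp _ x hx, hφsupp x hx]
  have hζ : ζ = ∑ i, ζ i • EuclideanSpace.single i (1 : ℝ) := by
    ext j
    simp [Finset.sum_apply, Pi.single_apply]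
  have h1 : ∀ x, K.indicator f x * fderiv ℝ φ x ζ =
      ∑ i, ζ i * (K.indicator f x * fderiv ℝ φ x (EuclideanSpace.single i 1)) := fun x => by
    conv_lhs => rw [hζ]
    simp only [map_sum, map_smul, smul_eq_mul, Finset.mul_sum]
    exact Finset.sum_congr rfl fun i _ => by ring
  have h2 : ∀ x, inner ℝ (K.indicator g x) ζ * φ x = ∑ i, ζ i * (K.indicator g x i * φ x) :=
    fun x => by
    simp only [PiLp.inner_apply, Finset.sum_mul]
    exact Finset.sum_congr rfl fun i _ => by simp; ring
  simp only [h1, h2]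
  rw [integral_finsetSum _ fun i _ => (hFD _).const_mul _,
    integral_finsetSum _ fun i _ => (hGφ i).const_mul (ζ i), ← Finset.sum_neg_distrib]
  refine Finset.sum_congr rfl fun i _ => ?_
  rw [integral_const_mul, integral_const_mul, key, mul_neg]

theorem measurePreserving_add_smul {N : ℕ} (ζ : Space N) :
    MeasurePreserving (fun q : ℝ × Space N => (q.1, q.2 + q.1 • ζ))
      ((volume.restrict (Ioc (0 : ℝ) 1)).prod volume)
      ((volume.restrict (Ioc (0 : ℝ) 1)).prod volume) :=
  (MeasurePreserving.id _).skew_product (g := fun t x => x + t • ζ)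
    (by simp only [Function.uncurry_def]; fun_prop)
    (.of_forall fun t => (measurePreserving_add_right volume (t • ζ)).map_eq)

theorem integrable_comp_add_smul {N : ℕ} {G : Space N → Space N} (hG : Integrable G)
    (ζ : Space N) :
    Integrable (fun q : ℝ × Space N => G (q.2 + q.1 • ζ))
      ((volume.restrict (Ioc (0 : ℝ) 1)).prod volume) :=
  (measurePreserving_add_smul ζ).integrable_comp_of_integrable (hG.comp_snd _)

/-- For a test function, the translation identity in weak form. -/
theorem IsWeakGradient.integral_mul_translate_sub {N : ℕ} {U K K₀ : Set (Space N)}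
    {f : Space N → ℝ} {g : Space N → Space N} (hw : IsWeakGradient U f g) (hK : IsCompact K)
    (hKU : K ⊆ U) {ζ : Space N} (hK₀ : ∀ x ∈ K₀, ∀ t ∈ Icc (0 : ℝ) 1, x + t • ζ ∈ K)
    {φ : Space N → ℝ} (hφ : ContDiff ℝ (⊤ : ℕ∞) φ) (hc : HasCompactSupport φ)
    (hφK : tsupport φ ⊆ K₀) :
    ∫ x, φ x * (K.indicator f (x + ζ) - K.indicator f x) =
      ∫ x, φ x * ∫ t in Ioc (0 : ℝ) 1, inner ℝ (K.indicator g (x + t • ζ)) ζ := by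
  have hF : Integrable (K.indicator f) := (integrable_indicator_iff hK.measurableSet).2
    ((hw.1.mono_set hKU).integrableOn_isCompact hK)
  have hG : Integrable (K.indicator g) := (integrable_indicator_iff hK.measurableSet).2
    ((hw.2.1.mono_set hKU).integrableOn_isCompact hK)
  obtain ⟨C, hC⟩ := hc.exists_bound_of_continuous hφ.continuous
  have hDcont : Continuous fun x => fderiv ℝ φ x ζ :=
    (hφ.continuous_fderiv (by simp)).clm_apply continuous_const
  obtain ⟨D, hD⟩ := (hc.fderiv_apply ℝ ζ).exists_bound_of_continuous hDcont
  -- the difference quotient as an integral along the segment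
  have hftc : ∀ x, φ (x - ζ) - φ x = -∫ t in Ioc (0 : ℝ) 1, fderiv ℝ φ (x - t • ζ) ζ := fun x => by
    have hd : ∀ t ∈ uIcc (0 : ℝ) 1,
        HasDerivAt (fun t : ℝ => φ (x - t • ζ)) (-fderiv ℝ φ (x - t • ζ) ζ) t := fun t _ => by
      have h1 : HasDerivAt (fun t : ℝ => x - t • ζ) (-ζ) t := by
        simpa using ((hasDerivAt_id t).smul_const ζ).const_sub x
      have h2 := ((hφ.differentiable (by simp)) (x - t • ζ)).hasFDerivAt.comp_hasDerivAt t h1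
      rwa [map_neg] at h2
    have h := intervalIntegral.integral_eq_sub_of_hasDerivAt hd
      (by
        refine Continuous.intervalIntegrable ?_ _ _
        exact (hDcont.comp (by fun_prop : Continuous fun t : ℝ => x - t • ζ)).neg)
    rw [intervalIntegral.integral_of_le zero_le_one, integral_neg] at h
    simpa using h.symm
  -- The weak identity is tested with the translate of `φ` by `t • ζ`, still supported in `K`
  -- because `K` contains the segments issuing from `K₀`.
  have hshift : ∀ t ∈ Ioc (0 : ℝ) 1,
      ∫ x, K.indicator f x * fderiv ℝ φ (x - t • ζ) ζ =
        -∫ x, inner ℝ (K.indicator g (x + t • ζ)) ζ * φ x := fun t ht => by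
    have hsub : tsupport (fun x => φ (x - t • ζ)) ⊆ K := fun x hx => by
      have h1 : x - t • ζ ∈ tsupport φ :=
        tsupport_comp_subset_preimage φ (f := fun x => x - t • ζ) (by fun_prop) hx
      have h2 := hK₀ _ (hφK h1) t (Ioc_subset_Icc_self ht)
      rwa [sub_add_cancel] at h2
    have h := hw.integral_mul_fderiv_eq hK hKU (φ := fun x => φ (x - t • ζ))
      (hφ.comp (contDiff_id.sub contDiff_const)) hsub ζ
    simp only [fderiv_comp_sub] at h
    rw [h, ← integral_add_right_eq_self _ (t • ζ)]
    simp only [add_sub_cancel_right]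
  have hint1 : Integrable (Function.uncurry fun (t : ℝ) x =>
      K.indicator f x * fderiv ℝ φ (x - t • ζ) ζ)
      ((volume.restrict (Ioc (0 : ℝ) 1)).prod volume) := by
    refine (hF.comp_snd _).mul_bdd (c := D) ?_ (.of_forall fun q => hD _)
    exact (hDcont.comp (by fun_prop : Continuous fun q : ℝ × Space N =>
      q.2 - q.1 • ζ)).aestronglyMeasurable
  have hint2 : Integrable (Function.uncurry fun (t : ℝ) x =>
      inner ℝ (K.indicator g (x + t • ζ)) ζ * φ x)
      ((volume.restrict (Ioc (0 : ℝ) 1)).prod volume) := by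
    refine Integrable.mul_bdd (c := C) ((integrable_comp_add_smul hG ζ).inner_const ζ) ?_
      (.of_forall fun q => hC _)
    exact (hφ.continuous.comp continuous_snd).aestronglyMeasurable
  calc ∫ x, φ x * (K.indicator f (x + ζ) - K.indicator f x)
      = ∫ x, φ (x - ζ) * K.indicator f x - φ x * K.indicator f x := by
        have i1 : Integrable fun x => φ x * K.indicator f (x + ζ) :=
          (hF.comp_add_right ζ).bdd_mul hφ.continuous.aestronglyMeasurable (.of_forall hC)
        have i2 : Integrable fun x => φ x * K.indicator f x :=
          hF.bdd_mul hφ.continuous.aestronglyMeasurable (.of_forall hC)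
        have i3 : Integrable fun x => φ (x - ζ) * K.indicator f x :=
          hF.bdd_mul (c := C)
            (hφ.continuous.comp (continuous_id.sub continuous_const)).aestronglyMeasurable
            (.of_forall fun x => hC _)
        simp only [mul_sub]
        rw [integral_sub i1 i2, integral_sub i3 i2,
          ← integral_add_right_eq_self (fun x => φ (x - ζ) * K.indicator f x) ζ]
        simp only [add_sub_cancel_right]
    _ = ∫ x, -∫ t in Ioc (0 : ℝ) 1, K.indicator f x * fderiv ℝ φ (x - t • ζ) ζ := by
        refine integral_congr_ae (.of_forall fun x => ?_)
        simp only
        rw [integral_const_mul, ← sub_mul, hftc]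
        ring
    _ = -∫ t in Ioc (0 : ℝ) 1, ∫ x, K.indicator f x * fderiv ℝ φ (x - t • ζ) ζ := by
        rw [integral_neg, integral_integral_swap hint1]
    _ = ∫ t in Ioc (0 : ℝ) 1, ∫ x, inner ℝ (K.indicator g (x + t • ζ)) ζ * φ x := by
        rw [← integral_neg]
        refine setIntegral_congr_fun measurableSet_Ioc fun t ht => ?_
        rw [hshift t ht, neg_neg]
    _ = ∫ x, φ x * ∫ t in Ioc (0 : ℝ) 1, inner ℝ (K.indicator g (x + t • ζ)) ζ := by
        rw [integral_integral_swap hint2]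
        refine integral_congr_ae (.of_forall fun x => ?_)
        simp only
        rw [integral_mul_const, mul_comm]

/-- A function with a weak gradient is, almost everywhere, the integral of the gradient along
segments of a fixed direction. -/
theorem IsWeakGradient.translate_sub_ae {N : ℕ} {U V : Set (Space N)} {f : Space N → ℝ}
    {g : Space N → Space N} (hw : IsWeakGradient U f g) (hV : IsOpen V) {ζ : Space N}
    (hVU : ∀ x ∈ V, ∀ t ∈ Icc (0 : ℝ) 1, x + t • ζ ∈ U) :
    ∀ᵐ x, x ∈ V → f (x + ζ) - f x = ∫ t in Ioc (0 : ℝ) 1, inner ℝ (g (x + t • ζ)) ζ := by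
  -- The set swept out by a compact set along the segments is compact and stays in `U`, so it serves
  -- as cut-off.
  have hseg : ∀ K₀ ⊆ V, IsCompact K₀ → ∃ K, IsCompact K ∧ K ⊆ U ∧
      ∀ x ∈ K₀, ∀ t ∈ Icc (0 : ℝ) 1, x + t • ζ ∈ K := fun K₀ h0 hc =>
    ⟨(fun q : Space N × ℝ => q.1 + q.2 • ζ) '' (K₀ ×ˢ Icc 0 1),
      (hc.prod isCompact_Icc).image (by fun_prop),
      by rintro _ ⟨q, hq, rfl⟩; exact hVU _ (h0 hq.1) _ hq.2,
      fun x hx t ht => ⟨(x, t), ⟨hx, ht⟩, rfl⟩⟩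
  have hcongr : ∀ {K K₀ : Set (Space N)}, (∀ x ∈ K₀, ∀ t ∈ Icc (0 : ℝ) 1, x + t • ζ ∈ K) →
      ∀ x ∈ K₀, (f (x + ζ) - f x - ∫ t in Ioc (0 : ℝ) 1, inner ℝ (g (x + t • ζ)) ζ) =
        K.indicator f (x + ζ) - K.indicator f x -
          ∫ t in Ioc (0 : ℝ) 1, inner ℝ (K.indicator g (x + t • ζ)) ζ := fun {K K₀} h x hx => by
    have h0 : x ∈ K := by simpa using h x hx 0 (by simp)
    have h1 : x + ζ ∈ K := by simpa using h x hx 1 (by simp)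
    rw [indicator_of_mem h0, indicator_of_mem h1]
    congr 1
    refine setIntegral_congr_fun measurableSet_Ioc fun t ht => ?_
    rw [indicator_of_mem (h x hx t (Ioc_subset_Icc_self ht))]
  have hint : ∀ {K : Set (Space N)}, IsCompact K → K ⊆ U →
      Integrable (fun x => K.indicator f (x + ζ) - K.indicator f x) ∧
      Integrable fun x => ∫ t in Ioc (0 : ℝ) 1, inner ℝ (K.indicator g (x + t • ζ)) ζ :=
    fun {K} hK hKU => by
    have hF : Integrable (K.indicator f) := (integrable_indicator_iff hK.measurableSet).2
      ((hw.1.mono_set hKU).integrableOn_isCompact hK)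
    have hG : Integrable (K.indicator g) := (integrable_indicator_iff hK.measurableSet).2
      ((hw.2.1.mono_set hKU).integrableOn_isCompact hK)
    exact ⟨(hF.comp_add_right ζ).sub hF,
      Integrable.integral_prod_right
        (f := fun q : ℝ × Space N => inner ℝ (K.indicator g (q.2 + q.1 • ζ)) ζ)
        ((integrable_comp_add_smul hG ζ).inner_const ζ)⟩
  have hloc : LocallyIntegrableOn
      (fun x => f (x + ζ) - f x - ∫ t in Ioc (0 : ℝ) 1, inner ℝ (g (x + t • ζ)) ζ) V := by
    rw [locallyIntegrableOn_iff hV.isLocallyClosed]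
    intro K₀ h0 hc
    obtain ⟨K, hK, hKU, hsub⟩ := hseg K₀ h0 hc
    exact (((hint hK hKU).1.sub (hint hK hKU).2).integrableOn).congr_fun
      (fun x hx => (hcongr hsub x hx).symm) hc.measurableSet
  have h := hV.ae_eq_zero_of_integral_contDiff_smul_eq_zero hloc fun φ hφ hc hφV => by
    obtain ⟨K, hK, hKU, hsub⟩ := hseg (tsupport φ) hφV hc
    obtain ⟨C, hC⟩ := hc.exists_bound_of_continuous hφ.continuous
    have h1 := hw.integral_mul_translate_sub hK hKU hsub hφ hc Subset.rfl
    have h2 : ∀ x, φ x • (f (x + ζ) - f x - ∫ t in Ioc (0 : ℝ) 1, inner ℝ (g (x + t • ζ)) ζ) =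
        φ x * (K.indicator f (x + ζ) - K.indicator f x) -
          φ x * ∫ t in Ioc (0 : ℝ) 1, inner ℝ (K.indicator g (x + t • ζ)) ζ := fun x => by
      by_cases hx : x ∈ tsupport φ
      · rw [hcongr hsub x hx, smul_eq_mul, mul_sub]
      · simp [image_eq_zero_of_notMem_tsupport hx]
    simp only [h2]
    rw [integral_sub
      ((hint hK hKU).1.bdd_mul hφ.continuous.aestronglyMeasurable (.of_forall hC))
      ((hint hK hKU).2.bdd_mul hφ.continuous.aestronglyMeasurable (.of_forall hC)), h1, sub_self]
  filter_upwards [h] with x hx hxV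
  exact sub_eq_zero.1 (hx hxV)

theorem lintegral_rpow_le_of_isProbabilityMeasure {α : Type*} [MeasurableSpace α] {μ : Measure α}
    [IsProbabilityMeasure μ] {p : ℝ} (hp : 1 ≤ p) {H : α → ENNReal} (hH : AEMeasurable H μ) :
    (∫⁻ a, H a ∂μ) ^ p ≤ ∫⁻ a, H a ^ p ∂μ := by
  have h := eLpNorm'_le_eLpNorm'_of_exponent_le one_pos hp μ hH.aestronglyMeasurable
  simp only [eLpNorm', enorm_eq_self, ENNReal.rpow_one, div_one] at h
  have h2 := ENNReal.rpow_le_rpow h (zero_le_one.trans hp)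
  rwa [← ENNReal.rpow_mul, one_div, inv_mul_cancel₀ (by linarith), ENNReal.rpow_one] at h2

theorem setLIntegral_comp_add_right_le {N : ℕ} {U V : Set (Space N)} (hU : MeasurableSet U)
    (hV : MeasurableSet V) {ζ : Space N} (h : ∀ x ∈ V, x + ζ ∈ U) (H : Space N → ENNReal) :
    ∫⁻ x in V, H (x + ζ) ≤ ∫⁻ x in U, H x := by
  rw [← lintegral_indicator hU, ← lintegral_indicator hV,
    ← lintegral_add_right_eq_self (U.indicator H) ζ]
  refine lintegral_mono fun x => ?_
  by_cases hx : x ∈ V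
  · rw [indicator_of_mem hx, indicator_of_mem (h x hx)]
  · rw [indicator_of_notMem hx]; exact zero_le

/-- Jensen's inequality on the segment formula, then Tonelli: each translation by `t • ζ` carries
`V` into `U`. Measurability of `g` itself makes `g (x + t • ζ)` jointly measurable. -/
theorem IsWeakGradient.lintegral_translate_sub_le {N : ℕ} {U V : Set (Space N)} {f : Space N → ℝ}
    {g : Space N → Space N} (hw : IsWeakGradient U f g) (hgm : Measurable g) (hU : IsOpen U)
    (hV : IsOpen V) {ζ : Space N} (hVU : ∀ x ∈ V, ∀ t ∈ Icc (0 : ℝ) 1, x + t • ζ ∈ U)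
    {p : ℝ} (hp : 1 ≤ p) :
    ∫⁻ x in V, ‖f (x + ζ) - f x‖ₑ ^ p ≤ ‖ζ‖ₑ ^ p * ∫⁻ x in U, ‖g x‖ₑ ^ p := by
  have hp0 : 0 ≤ p := zero_le_one.trans hp
  have : IsProbabilityMeasure ((volume : Measure ℝ).restrict (Ioc 0 1)) :=
    ⟨by simp⟩
  have hm : Measurable fun q : Space N × ℝ => ‖g (q.1 + q.2 • ζ)‖ₑ ^ p :=
    ((hgm.comp (by fun_prop : Measurable fun q : Space N × ℝ => q.1 + q.2 • ζ)).enorm).pow_const p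
  calc ∫⁻ x in V, ‖f (x + ζ) - f x‖ₑ ^ p
      ≤ ∫⁻ x in V, ‖ζ‖ₑ ^ p * ∫⁻ t in Ioc (0 : ℝ) 1, ‖g (x + t • ζ)‖ₑ ^ p := by
        refine lintegral_mono_ae ?_
        rw [ae_restrict_iff' hV.measurableSet]
        filter_upwards [hw.translate_sub_ae hV hVU] with x hx hxV
        rw [hx hxV]
        have hmx : Measurable fun t : ℝ => ‖g (x + t • ζ)‖ₑ :=
          (hgm.comp (by fun_prop : Measurable fun t : ℝ => x + t • ζ)).enorm
        calc ‖∫ t in Ioc (0 : ℝ) 1, inner ℝ (g (x + t • ζ)) ζ‖ₑ ^ p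
            ≤ (∫⁻ t in Ioc (0 : ℝ) 1, ‖ζ‖ₑ * ‖g (x + t • ζ)‖ₑ) ^ p := by
              refine ENNReal.rpow_le_rpow ((enorm_integral_le_lintegral_enorm _).trans
                (lintegral_mono fun t => ?_)) hp0
              rw [← ofReal_norm, ← ofReal_norm, ← ofReal_norm,
                ← ENNReal.ofReal_mul (norm_nonneg _), mul_comm]
              exact ENNReal.ofReal_le_ofReal (norm_inner_le_norm _ _)
          _ ≤ _ := by
              rw [lintegral_const_mul _ hmx, ENNReal.mul_rpow_of_nonneg _ _ hp0]
              gcongr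
              exact lintegral_rpow_le_of_isProbabilityMeasure hp hmx.aemeasurable
    _ = ‖ζ‖ₑ ^ p * ∫⁻ t in Ioc (0 : ℝ) 1, ∫⁻ x in V, ‖g (x + t • ζ)‖ₑ ^ p := by
        rw [lintegral_const_mul _ hm.lintegral_prod_right', lintegral_lintegral_swap hm.aemeasurable]
    _ ≤ ‖ζ‖ₑ ^ p * ∫⁻ t in Ioc (0 : ℝ) 1, ∫⁻ x in U, ‖g x‖ₑ ^ p := by
        refine mul_le_mul' le_rfl (setLIntegral_mono' measurableSet_Ioc fun t ht => ?_)
        exact setLIntegral_comp_add_right_le (H := fun x => ‖g x‖ₑ ^ p) hU.measurableSet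
          hV.measurableSet fun x hx => hVU x hx t (Ioc_subset_Icc_self ht)
    _ = _ := by simp

theorem locallyIntegrableOn_congr_ae {X F : Type*} [TopologicalSpace X] [LocallyCompactSpace X]
    [MeasurableSpace X] [OpensMeasurableSpace X] [NormedAddCommGroup F] {μ : Measure X} {U : Set X}
    (hU : IsOpen U) {f f' : X → F} (hf : LocallyIntegrableOn f U μ)
    (h : f =ᵐ[μ.restrict U] f') : LocallyIntegrableOn f' U μ := by
  rw [locallyIntegrableOn_iff hU.isLocallyClosed] at hf ⊢
  exact fun K hKU hK => (hf K hKU hK).congr (ae_restrict_of_ae_restrict_of_subset hKU h)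

theorem IsWeakGradient.congr_ae {N : ℕ} {U : Set (Space N)} (hU : IsOpen U)
    {f f' : Space N → ℝ} {g g' : Space N → Space N} (hw : IsWeakGradient U f g)
    (hf : f =ᵐ[volume.restrict U] f') (hg : g =ᵐ[volume.restrict U] g') :
    IsWeakGradient U f' g' := by
  refine ⟨locallyIntegrableOn_congr_ae hU hw.1 hf, locallyIntegrableOn_congr_ae hU hw.2.1 hg,
    fun φ h1 h2 h3 i => ?_⟩
  have h := hw.2.2 φ h1 h2 h3 i
  rwa [integral_congr_ae (g := fun x => f' x * fderiv ℝ φ x (EuclideanSpace.single i 1))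
    (hf.mono fun x hx => by simp only [hx]),
    integral_congr_ae (f := fun x => g x i * φ x) (g := fun x => g' x i * φ x) (hg.mono fun x hx => by simp only [hx])] at h

/-! ### The Poincaré-type inequality for functions with small support. -/

/-- The indicator function of the nonzero reals. -/
def nonzeroIndicator (a : ℝ) : ENNReal := ({0}ᶜ : Set ℝ).indicator 1 a

theorem measurable_nonzeroIndicator : Measurable nonzeroIndicator :=
  measurable_one.indicator (measurableSet_singleton 0).compl

theorem nonzeroIndicator_zero : nonzeroIndicator 0 = 0 := by simp [nonzeroIndicator]

theorem nonzeroIndicator_of_ne {a : ℝ} (h : a ≠ 0) : nonzeroIndicator a = 1 := by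
  simp [nonzeroIndicator, h]

theorem enorm_le_of_mem_cube {N : ℕ} {h : ℝ} {ζ : Space N} (hζ : ζ ∈ cube 0 h) :
    ‖ζ‖ₑ ≤ ENNReal.ofReal (Real.sqrt N * h) := by
  rw [← ofReal_norm]
  refine ENNReal.ofReal_le_ofReal ?_
  rcases isEmpty_or_nonempty (Fin N) with h0 | ⟨⟨i⟩⟩
  · have : N = 0 := by
      by_contra h1
      exact h0.elim ⟨0, Nat.pos_of_ne_zero h1⟩
    subst this
    simp [EuclideanSpace.norm_eq]
  have hh : 0 ≤ h := (abs_nonneg _).trans (hζ i).le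
  rw [EuclideanSpace.norm_eq]
  refine Real.sqrt_le_iff.2 ⟨by positivity, ?_⟩
  rw [mul_pow, Real.sq_sqrt (Nat.cast_nonneg N)]
  refine (Finset.sum_le_sum fun i _ => (?_ : ‖ζ i‖ ^ 2 ≤ h ^ 2)).trans (by simp)
  have := hζ i
  simp only [PiLp.zero_apply, sub_zero] at this
  exact pow_le_pow_left₀ (norm_nonneg _) this.le 2

/-- For each `ζ`, either `f (x + ζ)` vanishes, and `|f x|` is the size of the increment, or `x + ζ`
lies in the set where `f` is nonzero. Integrating over `ζ` in the cube of edge `2h`, the increments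
are controlled by the gradient and the remaining `ζ` by the measure of that set. -/
theorem IsWeakGradient.lintegral_cube_le_of_measurable {N : ℕ} {y : Space N} {ρ ρ' h : ℝ}
    (hρ : ρ' + h ≤ ρ) {f : Space N → ℝ} {g : Space N → Space N}
    (hw : IsWeakGradient (cube y ρ) f g) (hf : Measurable f) (hg : Measurable g) {p : ℝ}
    (hp : 1 ≤ p) :
    ENNReal.ofReal (2 * h) ^ N * ∫⁻ x in cube y ρ', ‖f x‖ₑ ^ p ≤
      ENNReal.ofReal (2 * h) ^ N * (ENNReal.ofReal (Real.sqrt N * h) ^ p *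
        ∫⁻ x in cube y ρ, ‖g x‖ₑ ^ p) +
      (∫⁻ x in cube y ρ, nonzeroIndicator (f x)) * ∫⁻ x in cube y ρ', ‖f x‖ₑ ^ p := by
  have hp0 : 0 < p := zero_lt_one.trans_le hp
  have hmem : ∀ ζ ∈ cube (0 : Space N) h, ∀ x ∈ cube y ρ', ∀ t ∈ Icc (0 : ℝ) 1,
      x + t • ζ ∈ cube y ρ := fun ζ hζ x hx t ht i => by
    have h1 : |x i - y i| < ρ' := hx i
    have h2 : |ζ i - 0| < h := hζ i
    rw [sub_zero] at h2
    have h3 : |t * ζ i| ≤ |ζ i| := by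
      rw [abs_mul, abs_of_nonneg ht.1]
      exact mul_le_of_le_one_left (abs_nonneg _) ht.2
    have h4 := abs_add_le (x i - y i) (t * ζ i)
    have h5 : (x + t • ζ) i - y i = (x i - y i) + t * ζ i := by simp; ring
    rw [h5]
    linarith
  have hmem1 : ∀ ζ ∈ cube (0 : Space N) h, ∀ x ∈ cube y ρ', ζ + x ∈ cube y ρ :=
    fun ζ hζ x hx => by simpa [add_comm] using hmem ζ hζ x hx 1 (by simp)
  have hm1 : Measurable fun q : Space N × Space N => ‖f (q.1 + q.2) - f q.1‖ₑ ^ p :=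
    (((hf.comp (measurable_fst.add measurable_snd)).sub (hf.comp measurable_fst)).enorm).pow_const p
  have hpt : ∀ a b : ℝ, ‖a‖ₑ ^ p ≤ ‖b - a‖ₑ ^ p + nonzeroIndicator b * ‖a‖ₑ ^ p := fun a b => by
    by_cases hb : b = 0
    · rw [hb, nonzeroIndicator_zero, zero_mul, add_zero, zero_sub, enorm_neg]
    · rw [nonzeroIndicator_of_ne hb, one_mul]
      exact le_add_self
  calc ENNReal.ofReal (2 * h) ^ N * ∫⁻ x in cube y ρ', ‖f x‖ₑ ^ p
      = ∫⁻ x in cube y ρ', ∫⁻ _ in cube (0 : Space N) h, ‖f x‖ₑ ^ p := by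
        simp only [setLIntegral_const, volume_cube]
        rw [lintegral_mul_const _ (hf.enorm.pow_const p), mul_comm]
    _ ≤ ∫⁻ x in cube y ρ', ((∫⁻ ζ in cube (0 : Space N) h, ‖f (x + ζ) - f x‖ₑ ^ p) +
          (∫⁻ x in cube y ρ, nonzeroIndicator (f x)) * ‖f x‖ₑ ^ p) := by
        refine setLIntegral_mono' (measurableSet_cube _ _) fun x hx => ?_
        have hmx : Measurable fun ζ => nonzeroIndicator (f (x + ζ)) :=
          measurable_nonzeroIndicator.comp (hf.comp (measurable_const_add x))
        calc ∫⁻ _ in cube (0 : Space N) h, ‖f x‖ₑ ^ p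
            ≤ ∫⁻ ζ in cube (0 : Space N) h, (‖f (x + ζ) - f x‖ₑ ^ p +
                nonzeroIndicator (f (x + ζ)) * ‖f x‖ₑ ^ p) := lintegral_mono fun ζ => hpt _ _
          _ = (∫⁻ ζ in cube (0 : Space N) h, ‖f (x + ζ) - f x‖ₑ ^ p) +
                (∫⁻ ζ in cube (0 : Space N) h, nonzeroIndicator (f (ζ + x))) * ‖f x‖ₑ ^ p := by
              rw [lintegral_add_right _ (hmx.mul_const _), lintegral_mul_const _ hmx]
              simp only [add_comm]
          _ ≤ _ := by
              refine add_le_add le_rfl (mul_le_mul' ?_ le_rfl)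
              exact setLIntegral_comp_add_right_le (H := fun x => nonzeroIndicator (f x))
                (measurableSet_cube y ρ) (measurableSet_cube 0 h) fun ζ hζ => hmem1 ζ hζ x hx
    _ = (∫⁻ ζ in cube (0 : Space N) h, ∫⁻ x in cube y ρ', ‖f (x + ζ) - f x‖ₑ ^ p) +
          (∫⁻ x in cube y ρ, nonzeroIndicator (f x)) * ∫⁻ x in cube y ρ', ‖f x‖ₑ ^ p := by
        rw [lintegral_add_left hm1.lintegral_prod_right',
          lintegral_const_mul _ (hf.enorm.pow_const p), lintegral_lintegral_swap hm1.aemeasurable]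
    _ ≤ (∫⁻ _ in cube (0 : Space N) h, ENNReal.ofReal (Real.sqrt N * h) ^ p *
          ∫⁻ x in cube y ρ, ‖g x‖ₑ ^ p) +
          (∫⁻ x in cube y ρ, nonzeroIndicator (f x)) * ∫⁻ x in cube y ρ', ‖f x‖ₑ ^ p := by
        refine add_le_add_left (setLIntegral_mono' (measurableSet_cube _ _) fun ζ hζ => ?_) _
        refine (hw.lintegral_translate_sub_le hg (isOpen_cube _ _) (isOpen_cube _ _)
          (hmem ζ hζ) hp).trans ?_
        gcongr
        exact enorm_le_of_mem_cube hζ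
    _ = _ := by
        rw [setLIntegral_const, volume_cube, mul_comm (ENNReal.ofReal (2 * h) ^ N)]

/-- A function on a cube that vanishes on most of the cube is controlled by its gradient. -/
theorem IsWeakGradient.lintegral_cube_le {N : ℕ} {y : Space N} {ρ ρ' h : ℝ}
    (hρ : ρ' + h ≤ ρ) (hh : 0 ≤ h) {f : Space N → ℝ} {g : Space N → Space N}
    (hw : IsWeakGradient (cube y ρ) f g) {p : ℝ} (hp : 1 ≤ p) :
    ENNReal.ofReal (2 * h) ^ N * ∫⁻ x in cube y ρ', ‖f x‖ₑ ^ p ≤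
      ENNReal.ofReal (2 * h) ^ N * (ENNReal.ofReal (Real.sqrt N * h) ^ p *
        ∫⁻ x in cube y ρ, ‖g x‖ₑ ^ p) +
      (∫⁻ x in cube y ρ, nonzeroIndicator (f x)) * ∫⁻ x in cube y ρ', ‖f x‖ₑ ^ p := by
  have hfm : AEStronglyMeasurable f (volume.restrict (cube y ρ)) := hw.1.aestronglyMeasurable
  have hgm : AEStronglyMeasurable g (volume.restrict (cube y ρ)) := hw.2.1.aestronglyMeasurable
  have hw' := hw.congr_ae (isOpen_cube y ρ) hfm.ae_eq_mk hgm.ae_eq_mk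
  have h := hw'.lintegral_cube_le_of_measurable hρ hfm.stronglyMeasurable_mk.measurable
    hgm.stronglyMeasurable_mk.measurable hp
  have hsub : cube y ρ' ⊆ cube y ρ :=
    cube_subset_cube fun i => by rw [sub_self, abs_zero]; linarith
  have e1 : ∫⁻ x in cube y ρ', ‖hfm.mk f x‖ₑ ^ p = ∫⁻ x in cube y ρ', ‖f x‖ₑ ^ p :=
    lintegral_congr_ae ((ae_restrict_of_ae_restrict_of_subset hsub hfm.ae_eq_mk).mono
      fun x hx => by simp only [hx])
  have e2 : ∫⁻ x in cube y ρ, ‖hgm.mk g x‖ₑ ^ p = ∫⁻ x in cube y ρ, ‖g x‖ₑ ^ p :=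
    lintegral_congr_ae (hgm.ae_eq_mk.mono fun x hx => by simp only [hx])
  have e3 : ∫⁻ x in cube y ρ, nonzeroIndicator (hfm.mk f x) =
      ∫⁻ x in cube y ρ, nonzeroIndicator (f x) :=
    lintegral_congr_ae (hfm.ae_eq_mk.mono fun x hx => by simp only [hx])
  rwa [e1, e2, e3] at h

/-- The space-time version: integration in time of `IsWeakGradient.lintegral_cube_le`. -/
theorem IsSpatialGradient.lintegral_parabolicCylinder_le {N : ℕ} {y : Space N} {s τ ρ ρ' h : ℝ}
    (hρ : ρ' + h ≤ ρ) (hh : 0 ≤ h) {v : Space N × ℝ → ℝ} {g : Space N × ℝ → Space N}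
    (hg : IsSpatialGradient y s ρ τ v g)
    (hv : AEMeasurable v (volume.restrict (parabolicCylinder y s ρ τ))) {p : ℝ} (hp : 1 ≤ p)
    {S : ENNReal}
    (hS : ∀ᵐ t ∂(volume.restrict (Ioo (s - τ) s)), ∫⁻ x in cube y ρ, ‖v (x, t)‖ₑ ^ p ≤ S) :
    ENNReal.ofReal (2 * h) ^ N * ∫⁻ z in parabolicCylinder y s ρ' τ, ‖v z‖ₑ ^ p ≤
      ENNReal.ofReal (2 * h) ^ N * (ENNReal.ofReal (Real.sqrt N * h) ^ p *
        ∫⁻ z in parabolicCylinder y s ρ τ, ‖g z‖ₑ ^ p) +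
      (∫⁻ z in parabolicCylinder y s ρ τ, nonzeroIndicator (v z)) * S := by
  have hsub : cube y ρ' ⊆ cube y ρ :=
    cube_subset_cube fun i => by rw [sub_self, abs_zero]; linarith
  have hsub' : parabolicCylinder y s ρ' τ ⊆ parabolicCylinder y s ρ τ := prod_mono hsub Subset.rfl
  have hv' := hv.mono_measure (Measure.restrict_mono hsub' le_rfl)
  obtain ⟨hgm, hw⟩ := hg
  have hgm' := hgm.enorm.pow_const p
  rw [restrict_parabolicCylinder] at hv hv' hgm'
  have hvm := hv'.enorm.pow_const p
  have hχ : AEMeasurable (fun z => nonzeroIndicator (v z))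
      ((volume.restrict (cube y ρ)).prod (volume.restrict (Ioo (s - τ) s))) :=
    measurable_nonzeroIndicator.comp_aemeasurable hv
  rw [restrict_parabolicCylinder, restrict_parabolicCylinder, lintegral_prod_symm _ hvm,
    lintegral_prod_symm _ hgm', lintegral_prod_symm _ hχ, ← lintegral_const_mul'' _ hvm.lintegral_prod_left',
    ← lintegral_const_mul'' _ hgm'.lintegral_prod_left',
    ← lintegral_const_mul'' _ (hgm'.lintegral_prod_left'.const_mul _),
    ← lintegral_mul_const'' _ hχ.lintegral_prod_left',
    ← lintegral_add_right' _ (hχ.lintegral_prod_left'.mul_const _)]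
  refine lintegral_mono_ae ?_
  filter_upwards [hw, hS] with t ht hSt
  -- The bound uniform in time is used here: it takes the slice mass out of the product with the
  -- slice measure, which would not integrate otherwise.
  refine (ht.lintegral_cube_le hρ hh hp).trans (add_le_add_right (mul_le_mul_right ?_ _) _)
  exact (lintegral_mono_set hsub).trans hSt

/-! ### The De Giorgi iteration. -/

/-- The integral of `(u - k)_±^p` over `(y,s) + Q_{r, r^p}`. -/
def powerMass {N : ℕ} (sgn : Side) (p : ℝ) (u : Space N × ℝ → ℝ) (y : Space N) (s r k : ℝ) :
    ENNReal :=
  ∫⁻ z in parabolicCylinder y s r (r ^ p), ENNReal.ofReal (trunc sgn (u z) k) ^ p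

theorem trunc_shiftLevel_le (sgn : Side) (a k : ℝ) {δ : ℝ} (hδ : 0 ≤ δ) :
    trunc sgn a (shiftLevel sgn k δ) ≤ trunc sgn a k := by
  rw [trunc_shiftLevel sgn a k hδ]
  exact max_le (by linarith) (trunc_nonneg sgn a k)

theorem powerMass_shiftLevel_le {N : ℕ} (sgn : Side) {p : ℝ} (hp : 0 ≤ p) (u : Space N × ℝ → ℝ)
    (y : Space N) (s r k : ℝ) {δ : ℝ} (hδ : 0 ≤ δ) :
    powerMass sgn p u y s r (shiftLevel sgn k δ) ≤ powerMass sgn p u y s r k :=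
  lintegral_mono fun _ => ENNReal.rpow_le_rpow
    (ENNReal.ofReal_le_ofReal (trunc_shiftLevel_le sgn _ k hδ)) hp

/-- Chebyshev's inequality in pointwise form: where the truncation at the shifted level survives,
the original one exceeds `δ`. -/
theorem nonzeroIndicator_trunc_shiftLevel_le (sgn : Side) (a k : ℝ) {δ p : ℝ} (hδ : 0 < δ)
    (hp : 0 ≤ p) :
    nonzeroIndicator (trunc sgn a (shiftLevel sgn k δ)) ≤
      ENNReal.ofReal (δ⁻¹ ^ p) * ENNReal.ofReal (trunc sgn a k) ^ p := by
  by_cases h : trunc sgn a (shiftLevel sgn k δ) = 0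
  · rw [h, nonzeroIndicator_zero]; exact zero_le
  rw [nonzeroIndicator_of_ne h, ENNReal.ofReal_rpow_of_nonneg (trunc_nonneg _ _ _) hp,
    ← ENNReal.ofReal_mul (by positivity), ← Real.mul_rpow (by positivity) (trunc_nonneg _ _ _),
    ENNReal.one_le_ofReal]
  refine Real.one_le_rpow ?_ hp
  rw [trunc_shiftLevel sgn a k hδ.le] at h
  have h1 : δ < trunc sgn a k := by
    by_contra h2
    exact h (max_eq_right (by linarith))
  rw [inv_mul_eq_div, le_div_iff₀ hδ]
  linarith

/-- The order of choice matters: the averaging scale `κ` first makes the gradient term at most half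
of the target, then `ε`, depending on `κ`, does the same for the measure term. -/
theorem exists_small_scale (N : ℕ) {p Λ η : ℝ} (hp : 0 < p) (hΛ : 0 < Λ) (hη : 0 < η) :
    ∃ κ ε : ℝ, 0 < κ ∧ κ ≤ 1 / 4 ∧ 0 < ε ∧
      (2 * κ) ^ N * ((Real.sqrt N * κ) ^ p * Λ) + ε * Λ ≤ (2 * κ) ^ N * η := by
  set a : ℝ := (η / (2 * Λ)) ^ p⁻¹ / (Real.sqrt N + 1) with ha
  have hs : 0 < Real.sqrt N + 1 := by positivity
  have ha0 : 0 < a := by positivity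
  have hκ : 0 < min (1 / 4) a := lt_min (by norm_num) ha0
  refine ⟨min (1 / 4) a, (2 * min (1 / 4) a) ^ N * η / (2 * Λ), hκ, min_le_left _ _,
    by positivity, ?_⟩
  have h1 : Real.sqrt N * min (1 / 4) a ≤ (η / (2 * Λ)) ^ p⁻¹ := by
    calc Real.sqrt N * min (1 / 4) a ≤ (Real.sqrt N + 1) * a := by
          gcongr
          · linarith
          · exact min_le_right _ _
      _ = _ := by rw [ha]; field_simp
  have h2 : (Real.sqrt N * min (1 / 4) a) ^ p ≤ η / (2 * Λ) := by
    refine (Real.rpow_le_rpow (by positivity) h1 hp.le).trans_eq ?_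
    rw [← Real.rpow_mul (by positivity), inv_mul_cancel₀ hp.ne', Real.rpow_one]
  have h3 : (Real.sqrt N * min (1 / 4) a) ^ p * Λ ≤ η / 2 := by
    refine (mul_le_mul_of_nonneg_right h2 hΛ.le).trans_eq ?_
    field_simp
  have h4 : (2 * min (1 / 4) a) ^ N * η / (2 * Λ) * Λ = (2 * min (1 / 4) a) ^ N * (η / 2) := by
    field_simp
  rw [h4, ← mul_add]
  gcongr
  linarith

/-- One step of the De Giorgi iteration: smallness of the mass of the truncation at level `k` on a
cylinder propagates to the cylinder with a quarter of the radius at the shifted level. -/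
theorem exists_powerMass_step (N : ℕ) {p γ : ℝ} (hp : 1 < p) (hγ : 0 < γ) :
    ∃ ε : ℝ, 0 < ε ∧ ∀ (sgn : Side) (u : Space N × ℝ → ℝ) (y : Space N) (s r k δ : ℝ),
      0 < r → 0 < δ → AEMeasurable u (volume.restrict (parabolicCylinder y s r (r ^ p))) →
      EnergyInequality sgn p γ u y s r (r ^ p) (r / 2) ((r / 2) ^ p) (shiftLevel sgn k δ) →
      powerMass sgn p u y s r k ≤ ENNReal.ofReal (ε * δ ^ p * r ^ (N + p)) →
      powerMass sgn p u y s (r / 4) (shiftLevel sgn k δ) ≤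
        ENNReal.ofReal (ε * (δ / 2) ^ p * (r / 4) ^ (N + p)) := by
  have hp0 : 0 < p := by linarith
  have h2p : (1 / 2 : ℝ) ^ p < 1 := Real.rpow_lt_one (by norm_num) (by norm_num) hp0
  set Λ : ℝ := γ / (1 / 2) ^ p + γ / (1 - (1 / 2) ^ p) with hΛ
  have hΛ0 : 0 < Λ := by
    have : 0 < 1 - (1 / 2 : ℝ) ^ p := by linarith
    positivity
  -- The target `η` is the factor gained when `δ` is halved and `r` is divided by 4. The bound `κ ≤
  -- 1/4` leaves room for averaging between radii `r/4` and `r/2`.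
  obtain ⟨κ, ε, hκ, hκ4, hε, hκε⟩ := exists_small_scale N hp0 hΛ0
    (η := (1 / 2) ^ p * (1 / 4) ^ (N + p)) (by positivity)
  refine ⟨ε, hε, fun sgn u y s r k δ hr hδ hu hE hY => ?_⟩
  obtain ⟨g, hg, hE⟩ := hE
  set k' := shiftLevel sgn k δ with hk'
  set v : Space N × ℝ → ℝ := fun z => trunc sgn (u z) k' with hv
  have hrp : 0 < r ^ p := by positivity
  have hc : γ / (r - r / 2) ^ p + γ / (r ^ p - (r / 2) ^ p) = Λ / r ^ p := by
    have e1 : (r / 2) ^ p = (1 / 2) ^ p * r ^ p := by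
      rw [← Real.mul_rpow (by norm_num) hr.le]; congr 1; ring
    have : 1 - (1 / 2 : ℝ) ^ p ≠ 0 := by linarith
    rw [sub_half, e1, hΛ]
    rw [show r ^ p - (1 / 2) ^ p * r ^ p = (1 - (1 / 2) ^ p) * r ^ p by ring]
    field_simp
  set B : ℝ := ε * δ ^ p * r ^ (N + p) with hB
  have hB0 : 0 < B := by positivity
  have hE' : essSup (fun t => ∫⁻ x in cube y (r / 2), ENNReal.ofReal (v (x, t)) ^ p)
      (volume.restrict (Ioo (s - (r / 2) ^ p) s)) +
      ∫⁻ z in parabolicCylinder y s (r / 2) ((r / 2) ^ p), ‖g z‖ₑ ^ p ≤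
        ENNReal.ofReal (Λ / r ^ p * B) := by
    refine hE.trans ?_
    rw [hc, ENNReal.ofReal_mul (by positivity)]
    gcongr
    exact (powerMass_shiftLevel_le sgn hp0.le u y s r k hδ.le).trans hY
  have hS : ∀ᵐ t ∂(volume.restrict (Ioo (s - (r / 2) ^ p) s)),
      ∫⁻ x in cube y (r / 2), ‖v (x, t)‖ₑ ^ p ≤ ENNReal.ofReal (Λ / r ^ p * B) := by
    filter_upwards [ENNReal.ae_le_essSup
      (fun t => ∫⁻ x in cube y (r / 2), ENNReal.ofReal (v (x, t)) ^ p)] with t ht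
    simp only [Real.enorm_of_nonneg (trunc_nonneg _ _ _), hv]
    exact ht.trans (le_self_add.trans hE')
  have hG : ∫⁻ z in parabolicCylinder y s (r / 2) ((r / 2) ^ p), ‖g z‖ₑ ^ p ≤
      ENNReal.ofReal (Λ / r ^ p * B) := le_add_self.trans hE'
  have hsub : parabolicCylinder y s (r / 2) ((r / 2) ^ p) ⊆ parabolicCylinder y s r (r ^ p) :=
    parabolicCylinder_subset (fun i => by rw [sub_self, abs_zero]; linarith)
      (sub_le_sub_left (Real.rpow_le_rpow (by positivity) (by linarith) hp0.le) s) le_rfl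
  have hsub' : parabolicCylinder y s (r / 4) ((r / 4) ^ p) ⊆
      parabolicCylinder y s (r / 4) ((r / 2) ^ p) :=
    parabolicCylinder_subset (fun i => by rw [sub_self, abs_zero]; linarith)
      (sub_le_sub_left (Real.rpow_le_rpow (by positivity) (by linarith) hp0.le) s) le_rfl
  have hvm : AEMeasurable v
      (volume.restrict (parabolicCylinder y s (r / 2) ((r / 2) ^ p))) :=
    (measurable_trunc sgn k').comp_aemeasurable
      (hu.mono_measure (Measure.restrict_mono hsub le_rfl))
  have hum : AEMeasurable (fun z => ENNReal.ofReal (trunc sgn (u z) k) ^ p)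
      (volume.restrict (parabolicCylinder y s r (r ^ p))) :=
    (((measurable_trunc sgn k).ennreal_ofReal.pow_const p).comp_aemeasurable hu)
  -- The factor `δ^p` of the hypothesis cancels that of Chebyshev, so `ε` alone governs the relative
  -- measure.
  have hχ : ∫⁻ z in parabolicCylinder y s (r / 2) ((r / 2) ^ p), nonzeroIndicator (v z) ≤
      ENNReal.ofReal (ε * r ^ (N + p)) := by
    refine (lintegral_mono fun z =>
      nonzeroIndicator_trunc_shiftLevel_le sgn (u z) k hδ hp0.le).trans
      ((lintegral_mono_set hsub).trans ?_)
    rw [lintegral_const_mul'' _ hum]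
    refine (mul_le_mul' le_rfl hY).trans_eq ?_
    rw [← ENNReal.ofReal_mul (by positivity), hB, Real.inv_rpow hδ.le]
    congr 1
    field_simp
  have key := hg.lintegral_parabolicCylinder_le (ρ' := r / 4) (h := κ * r) (by nlinarith)
    (by positivity) hvm hp.le hS
  have hpos : 0 < 2 * (κ * r) := by positivity
  have key2 : ENNReal.ofReal (2 * (κ * r)) ^ N *
      ∫⁻ z in parabolicCylinder y s (r / 4) ((r / 2) ^ p), ‖v z‖ₑ ^ p ≤
      ENNReal.ofReal (2 * (κ * r)) ^ N * ENNReal.ofReal (ε * (δ / 2) ^ p * (r / 4) ^ (N + p)) := by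
    refine (key.trans (add_le_add (mul_le_mul' le_rfl (mul_le_mul' le_rfl hG))
      (mul_le_mul' hχ le_rfl))).trans ?_
    rw [ENNReal.ofReal_rpow_of_nonneg (by positivity) hp0.le, ← ENNReal.ofReal_pow hpos.le,
      ← ENNReal.ofReal_mul (by positivity), ← ENNReal.ofReal_mul (by positivity),
      ← ENNReal.ofReal_mul (by positivity), ← ENNReal.ofReal_mul (by positivity),
      ← ENNReal.ofReal_add (by positivity) (by positivity)]
    refine ENNReal.ofReal_le_ofReal ?_
    have e1 : (Real.sqrt N * (κ * r)) ^ p = (Real.sqrt N * κ) ^ p * r ^ p := by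
      rw [← mul_assoc, Real.mul_rpow (by positivity) hr.le]
    have e2 : (δ / 2) ^ p = (1 / 2) ^ p * δ ^ p := by
      rw [← Real.mul_rpow (by norm_num) hδ.le]; congr 1; ring
    have e3 : (r / 4) ^ (N + p) = (1 / 4) ^ (N + p) * r ^ (N + p) := by
      rw [← Real.mul_rpow (by norm_num) hr.le]; congr 1; ring
    have e4 : r ^ (N + p) = r ^ N * r ^ p := by rw [Real.rpow_add hr, Real.rpow_natCast]
    calc (2 * (κ * r)) ^ N * ((Real.sqrt N * (κ * r)) ^ p * (Λ / r ^ p * B)) +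
          ε * r ^ (N + p) * (Λ / r ^ p * B)
        = r ^ N * B * ((2 * κ) ^ N * ((Real.sqrt N * κ) ^ p * Λ) + ε * Λ) := by
          rw [e1, e4, ← mul_assoc 2 κ r, mul_pow (2 * κ) r]
          field_simp
      _ ≤ r ^ N * B * ((2 * κ) ^ N * ((1 / 2) ^ p * (1 / 4) ^ (N + p))) := by gcongr
      _ = _ := by
          rw [e2, e3, hB, ← mul_assoc 2 κ r, mul_pow (2 * κ) r]
          ring
  have key3 := (ENNReal.mul_le_mul_iff_right (pow_ne_zero N (ENNReal.ofReal_pos.2 hpos).ne')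
    (ENNReal.pow_ne_top ENNReal.ofReal_ne_top)).1 key2
  refine (lintegral_mono_set hsub').trans (le_trans (le_of_eq ?_) key3)
  simp only [Real.enorm_of_nonneg (trunc_nonneg _ _ _), hv]

/-- The De Giorgi iteration. -/
theorem exists_powerMass_decay (N : ℕ) {p γ : ℝ} (hp : 1 < p) (hγ : 0 < γ) :
    ∃ ε : ℝ, 0 < ε ∧ ∀ (sgn : Side) (u : Space N × ℝ → ℝ) (y : Space N) (s r k δ : ℝ),
      0 < r → 0 < δ → AEMeasurable u (volume.restrict (parabolicCylinder y s r (r ^ p))) →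
      (∀ ρ k : ℝ, 0 < ρ → ρ ≤ r →
        EnergyInequality sgn p γ u y s ρ (ρ ^ p) (ρ / 2) ((ρ / 2) ^ p) k) →
      powerMass sgn p u y s r k ≤ ENNReal.ofReal (ε * δ ^ p * r ^ (N + p)) →
      ∀ n : ℕ, powerMass sgn p u y s (r / 4 ^ n) (shiftLevel sgn k (2 * δ)) ≤
        ENNReal.ofReal (ε * (δ / 2 ^ n) ^ p * (r / 4 ^ n) ^ (N + p)) := by
  obtain ⟨ε, hε, hstep⟩ := exists_powerMass_step N hp hγ
  refine ⟨ε, hε, fun sgn u y s r k δ hr hδ hu hE hY => ?_⟩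
  have hp0 : 0 < p := by linarith
  have hrn : ∀ n : ℕ, r / 4 ^ n ≤ r := fun n => div_le_self hr.le (one_le_pow₀ (by norm_num))
  -- The increments `δ / 2^j` for `j < n` sum to `2δ(1 - 2^{-n})`, so no level goes past the one
  -- shifted by `2δ`.
  have main : ∀ n : ℕ,
      powerMass sgn p u y s (r / 4 ^ n) (shiftLevel sgn k (2 * δ * (1 - 1 / 2 ^ n))) ≤
        ENNReal.ofReal (ε * (δ / 2 ^ n) ^ p * (r / 4 ^ n) ^ (N + p)) := by
    intro n
    induction n with
    | zero =>
      have : shiftLevel sgn k 0 = k := by cases sgn <;> simp [shiftLevel]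
      simpa [this] using hY
    | succ n ih =>
      have hsub : parabolicCylinder y s (r / 4 ^ n) ((r / 4 ^ n) ^ p) ⊆
          parabolicCylinder y s r (r ^ p) :=
        parabolicCylinder_subset (fun i => by rw [sub_self, abs_zero, zero_add]; exact hrn n)
          (sub_le_sub_left (Real.rpow_le_rpow (by positivity) (hrn n) hp0.le) s) le_rfl
      have h := hstep sgn u y s (r / 4 ^ n) _ (δ / 2 ^ n) (by positivity) (by positivity)
        (hu.mono_measure (Measure.restrict_mono hsub le_rfl))
        (hE _ _ (by positivity) (hrn n)) ih
      rw [shiftLevel_shiftLevel, div_div, div_div, ← pow_succ, ← pow_succ] at h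
      convert h using 3
      rw [pow_succ]
      field_simp
      ring
  intro n
  have e : shiftLevel sgn k (2 * δ) =
      shiftLevel sgn (shiftLevel sgn k (2 * δ * (1 - 1 / 2 ^ n))) (2 * δ * (1 / 2 ^ n)) := by
    rw [shiftLevel_shiftLevel]
    congr 1
    ring
  rw [e]
  exact (powerMass_shiftLevel_le sgn hp0.le u y s _ _ (by positivity)).trans (main n)

/-! ### From vanishing means at every centre to vanishing almost everywhere. -/

theorem measurableSet_mem_parabolicCylinder (N : ℕ) (r τ : ℝ) :
    MeasurableSet {q : (Space N × ℝ) × (Space N × ℝ) |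
      q.2 ∈ parabolicCylinder q.1.1 q.1.2 r τ} := by
  have : {q : (Space N × ℝ) × (Space N × ℝ) | q.2 ∈ parabolicCylinder q.1.1 q.1.2 r τ} =
      (⋂ i, {q | |q.2.1 i - q.1.1 i| < r}) ∩ ({q | q.1.2 - τ < q.2.2} ∩ {q | q.2.2 ≤ q.1.2}) := by
    ext q
    simp [parabolicCylinder, cube]
  rw [this]
  refine (MeasurableSet.iInter fun i => ?_).inter (MeasurableSet.inter ?_ ?_)
  · exact measurableSet_lt (by fun_prop) measurable_const
  · exact measurableSet_lt (by fun_prop) (by fun_prop)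
  · exact measurableSet_le (by fun_prop) (by fun_prop)

/-- Averaging over all centres `z₀` in a cylinder: a function whose integrals over the cylinders
`z₀ + Q_{r,τ'}` are at most `c` times their volume has a small integral over a slightly smaller
cylinder. -/
theorem setLIntegral_le_of_forall_center {N : ℕ} {y : Space N} {s ρ τ r τ' σ : ℝ}
    {W : Space N × ℝ → ENNReal} (hW : Measurable W) {c : ENNReal} (hr : 0 < r) (hrσ : r ≤ σ)
    (hτ' : 0 < τ') (hτ'σ : τ' ≤ σ)
    (h : ∀ z₀ ∈ parabolicCylinder y s ρ τ, ∫⁻ z in parabolicCylinder z₀.1 z₀.2 r τ', W z ≤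
      c * (ENNReal.ofReal (2 * r) ^ N * ENNReal.ofReal τ')) :
    ∫⁻ z in cube y (ρ - σ) ×ˢ Ioc (s - τ) (s - σ), W z ≤
      c * volume (parabolicCylinder y s ρ τ) := by
  set C := parabolicCylinder y s ρ τ with hC
  set V : ENNReal := ENNReal.ofReal (2 * r) ^ N * ENNReal.ofReal τ' with hV
  have hV0 : V ≠ 0 := mul_ne_zero (pow_ne_zero _ (ENNReal.ofReal_pos.2 (by linarith)).ne')
    (ENNReal.ofReal_pos.2 hτ').ne'
  have hVtop : V ≠ ⊤ := ENNReal.mul_ne_top (ENNReal.pow_ne_top ENNReal.ofReal_ne_top)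
    ENNReal.ofReal_ne_top
  set B : Set ((Space N × ℝ) × (Space N × ℝ)) :=
    {q | q.2 ∈ parabolicCylinder q.1.1 q.1.2 r τ'} with hB
  have hBm : MeasurableSet B := measurableSet_mem_parabolicCylinder N r τ'
  set f : (Space N × ℝ) → (Space N × ℝ) → ENNReal :=
    fun z₀ z => B.indicator (fun q => W q.2) (z₀, z) with hf
  have hfm : Measurable (Function.uncurry f) :=
    (hW.comp measurable_snd).indicator hBm
  -- The centres whose cylinder contains `z` form a cylinder reflected in time, starting at the time
  -- of `z`, of the same volume `V`. Removing a margin `σ` at the sides and at the top keeps all of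
  -- them in `C`.
  have hlow : ∀ z ∈ cube y (ρ - σ) ×ˢ Ioc (s - τ) (s - σ), V * W z ≤ ∫⁻ z₀ in C, f z₀ z := by
    intro z hz
    have hsub : cube z.1 r ×ˢ Ico z.2 (z.2 + τ') ⊆ C :=
      prod_mono ((cube_subset_cube fun i => by linarith [show |z.1 i - y i| < ρ - σ from hz.1 i]))
        fun t ht => ⟨hz.2.1.trans_le ht.1, by linarith [ht.2, hz.2.2]⟩
    calc V * W z = ∫⁻ z₀ in cube z.1 r ×ˢ Ico z.2 (z.2 + τ'), W z := by
          rw [setLIntegral_const, Measure.volume_eq_prod, Measure.prod_prod, volume_cube,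
            Real.volume_Ico, add_sub_cancel_left, mul_comm]
      _ = ∫⁻ z₀ in cube z.1 r ×ˢ Ico z.2 (z.2 + τ'), f z₀ z := by
          refine setLIntegral_congr_fun ((measurableSet_cube _ _).prod measurableSet_Ico)
            fun z₀ hz₀ => ?_
          have : (z₀, z) ∈ B := ⟨fun i => by rw [abs_sub_comm]; exact hz₀.1 i,
            by linarith [hz₀.2.2], hz₀.2.1⟩
          simp only [hf, indicator_of_mem this]
      _ ≤ _ := lintegral_mono_set hsub
  have hup : ∀ z₀ ∈ C, ∫⁻ z, f z₀ z ≤ c * V := fun z₀ hz₀ => by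
    refine le_trans (le_of_eq ?_) (h z₀ hz₀)
    rw [← lintegral_indicator (measurableSet_parabolicCylinder _ _ _ _)]
    rfl
  have hmain : V * ∫⁻ z in cube y (ρ - σ) ×ˢ Ioc (s - τ) (s - σ), W z ≤ V * (c * volume C) :=
    calc V * ∫⁻ z in cube y (ρ - σ) ×ˢ Ioc (s - τ) (s - σ), W z
        = ∫⁻ z in cube y (ρ - σ) ×ˢ Ioc (s - τ) (s - σ), V * W z := (lintegral_const_mul _ hW).symm
      _ ≤ ∫⁻ z in cube y (ρ - σ) ×ˢ Ioc (s - τ) (s - σ), ∫⁻ z₀ in C, f z₀ z :=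
          setLIntegral_mono' ((measurableSet_cube _ _).prod measurableSet_Ioc) hlow
      _ ≤ ∫⁻ z, ∫⁻ z₀ in C, f z₀ z := setLIntegral_le_lintegral _ _
      _ = ∫⁻ z₀ in C, ∫⁻ z, f z₀ z := (lintegral_lintegral_swap hfm.aemeasurable).symm
      _ ≤ ∫⁻ _ in C, c * V :=
          setLIntegral_mono' (measurableSet_parabolicCylinder _ _ _ _) hup
      _ = V * (c * volume C) := by rw [setLIntegral_const]; ring
  exact (ENNReal.mul_le_mul_iff_right hV0 hVtop).1 hmain

/-- A substitute for Lebesgue differentiation along cylinders: averaging over centres gives a zero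
integral on each smaller set, and these exhaust the cylinder up to its top face. -/
theorem ae_eq_zero_of_forall_center {N : ℕ} {y : Space N} {s ρ τ : ℝ}
    {W : Space N × ℝ → ENNReal} (hW : Measurable W) {r τ' : ℕ → ℝ} {c : ℕ → ENNReal}
    (hr : ∀ n, 0 < r n) (hr0 : Filter.Tendsto r Filter.atTop (nhds 0)) (hτ' : ∀ n, 0 < τ' n)
    (hτ'0 : Filter.Tendsto τ' Filter.atTop (nhds 0))
    (hc : Filter.Tendsto c Filter.atTop (nhds 0))
    (h : ∀ n, ∀ z₀ ∈ parabolicCylinder y s ρ τ,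
      ∫⁻ z in parabolicCylinder z₀.1 z₀.2 (r n) (τ' n), W z ≤
        c n * (ENNReal.ofReal (2 * r n) ^ N * ENNReal.ofReal (τ' n))) :
    ∀ᵐ z ∂(volume.restrict (parabolicCylinder y s ρ τ)), W z = 0 := by
  have hvol : volume (parabolicCylinder y s ρ τ) ≠ ⊤ := by
    rw [volume_parabolicCylinder]
    exact ENNReal.mul_ne_top (ENNReal.pow_ne_top ENNReal.ofReal_ne_top) ENNReal.ofReal_ne_top
  have hzero : ∀ σ : ℝ, 0 < σ → ∫⁻ z in cube y (ρ - σ) ×ˢ Ioc (s - τ) (s - σ), W z = 0 := by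
    intro σ hσ
    have hlim : Filter.Tendsto (fun n => c n * volume (parabolicCylinder y s ρ τ)) Filter.atTop
        (nhds 0) := by
      simpa using ENNReal.Tendsto.mul_const hc (Or.inr hvol)
    refine le_antisymm (ge_of_tendsto hlim ?_) zero_le
    filter_upwards [hr0.eventually_lt_const hσ, hτ'0.eventually_lt_const hσ] with n h1 h2
    exact setLIntegral_le_of_forall_center hW (hr n) h1.le (hτ' n) h2.le (h n)
  have hae : ∀ m : ℕ, ∀ᵐ z ∂(volume.restrict
      (cube y (ρ - 1 / ((m : ℝ) + 1)) ×ˢ Ioc (s - τ) (s - 1 / ((m : ℝ) + 1)))), W z = 0 :=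
    fun m => (lintegral_eq_zero_iff hW).1 (hzero _ (by positivity))
  have hcover : cube y ρ ×ˢ Ioo (s - τ) s ⊆
      ⋃ m : ℕ, cube y (ρ - 1 / ((m : ℝ) + 1)) ×ˢ Ioc (s - τ) (s - 1 / ((m : ℝ) + 1)) := by
    rintro z ⟨hz1, hz2⟩
    have ht := tendsto_one_div_add_atTop_nhds_zero_nat (𝕜 := ℝ)
    have h1 : ∀ᶠ m : ℕ in Filter.atTop, ∀ i, 1 / ((m : ℝ) + 1) < ρ - |z.1 i - y i| :=
      Filter.eventually_all.2 fun i => ht.eventually_lt_const (sub_pos.2 (hz1 i))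
    obtain ⟨m, hm1, hm2⟩ := (h1.and (ht.eventually_lt_const (sub_pos.2 hz2.2))).exists
    exact mem_iUnion.2 ⟨m, fun i => by linarith [hm1 i], hz2.1, by linarith⟩
  rw [restrict_parabolicCylinder, Measure.prod_restrict]
  exact ae_restrict_of_ae_restrict_of_subset hcover (ae_restrict_iUnion_iff _ _ |>.2 hae)

/-! ### The supremum bound by the integral of the `p`-th power. -/

/-- The energy inequality on cylinders adapted to the homogeneity, with half the radius. -/
theorem InGeneralizedClass.energyInequality_half {N : ℕ} {sgn : Side} {p : ℝ} (hp : 0 < p)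
    {A₀ : ℝ → ℝ → ℝ → ℝ → ℝ} (hA : IsHomogeneousQuantity p A₀) {E : Set (Space N × ℝ)}
    {u : Space N × ℝ → ℝ} (hu : InGeneralizedClass sgn p A₀ E u) {y : Space N} {s r : ℝ}
    (hr : 0 < r) (hE : closure (parabolicCylinder y s r (r ^ p)) ⊆ E) (k : ℝ) :
    EnergyInequality sgn p (A₀ 1 1 (1 / 2) ((1 / 2) ^ p)) u y s r (r ^ p) (r / 2)
      ((r / 2) ^ p) k := by
  obtain ⟨-, f, hf⟩ := hA
  have h2p : (1 / 2 : ℝ) ^ p < 1 := Real.rpow_lt_one (by norm_num) (by norm_num) hp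
  -- Homogeneity is evaluated at radii `1` and `r` with the same ratios, so the constant does not
  -- depend on `r`.
  have h1 := hf 1 (1 / 2) ((1 / 2) ^ p) one_pos (by norm_num) (by norm_num) (by positivity) h2p
  have h2 := hf r (1 / 2) ((1 / 2) ^ p) hr (by norm_num) (by norm_num) (by positivity) h2p
  rw [← Real.mul_rpow (by norm_num) hr.le, one_div_mul_eq_div] at h2
  simp only [Real.one_rpow, mul_one] at h1
  rw [h1, ← h2]
  exact (hu.2 y s r (r ^ p) hr (by positivity) hE).2 _ _ k (by positivity) (by linarith)
    (by positivity) (Real.rpow_lt_rpow (by positivity) (by linarith) hp)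

/-- The local bound of `(u - k)_±` by its `p`-th power integrals. -/
theorem exists_trunc_le_of_powerMass_le (N : ℕ) {p : ℝ} (hp : 1 < p) {A₀ : ℝ → ℝ → ℝ → ℝ → ℝ}
    (hA : IsHomogeneousQuantity p A₀) :
    ∃ ε : ℝ, 0 < ε ∧ ∀ (sgn : Side) (E : Set (Space N × ℝ)) (u : Space N × ℝ → ℝ),
      InGeneralizedClass sgn p A₀ E u → ∀ (y : Space N) (s ρ τ r k δ : ℝ), 0 < r → 0 < δ →
      (∀ z₀ ∈ parabolicCylinder y s ρ τ, closure (parabolicCylinder z₀.1 z₀.2 r (r ^ p)) ⊆ E) →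
      (∀ z₀ ∈ parabolicCylinder y s ρ τ,
        powerMass sgn p u z₀.1 z₀.2 r k ≤ ENNReal.ofReal (ε * δ ^ p * r ^ (N + p))) →
      ∀ᵐ z ∂(volume.restrict (parabolicCylinder y s ρ τ)), trunc sgn (u z) k ≤ 2 * δ := by
  have hp0 : 0 < p := by linarith
  have h2p : (1 / 2 : ℝ) ^ p < 1 := Real.rpow_lt_one (by norm_num) (by norm_num) hp0
  obtain ⟨ε, hε, hdecay⟩ := exists_powerMass_decay N hp (γ := A₀ 1 1 (1 / 2) ((1 / 2) ^ p))
    (hA.1 _ _ _ _ (by norm_num) (by norm_num) (by positivity) h2p)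
  refine ⟨ε, hε, fun sgn E u hu y s ρ τ r k δ hr hδ hE hY => ?_⟩
  set K := shiftLevel sgn k (2 * δ) with hK
  have hrn : ∀ n : ℕ, r / 4 ^ n ≤ r := fun n => div_le_self hr.le (one_le_pow₀ (by norm_num))
  have hsubr : ∀ (z₀ : Space N × ℝ) (r' : ℝ), 0 < r' → r' ≤ r →
      parabolicCylinder z₀.1 z₀.2 r' (r' ^ p) ⊆ parabolicCylinder z₀.1 z₀.2 r (r ^ p) :=
    fun z₀ r' h0 h => parabolicCylinder_subset (fun i => by rw [sub_self, abs_zero, zero_add]; exact h)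
      (sub_le_sub_left (Real.rpow_le_rpow h0.le h hp0.le) _) le_rfl
  have hWm : AEMeasurable (fun z => ENNReal.ofReal (trunc sgn (u z) K) ^ p)
      (volume.restrict E) :=
    ((measurable_trunc sgn K).ennreal_ofReal.pow_const p).comp_aemeasurable hu.1
  have hn : Filter.Tendsto (fun n : ℕ => (1 / 4 : ℝ) ^ n) Filter.atTop (nhds 0) :=
    tendsto_pow_atTop_nhds_zero_of_lt_one (by norm_num) (by norm_num)
  have hn2 : Filter.Tendsto (fun n : ℕ => (1 / 2 : ℝ) ^ n) Filter.atTop (nhds 0) :=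
    tendsto_pow_atTop_nhds_zero_of_lt_one (by norm_num) (by norm_num)
  have hr0 : Filter.Tendsto (fun n : ℕ => r / 4 ^ n) Filter.atTop (nhds 0) := by
    simpa [div_eq_mul_inv] using hn.const_mul r
  have hδ0 : Filter.Tendsto (fun n : ℕ => δ / 2 ^ n) Filter.atTop (nhds 0) := by
    simpa [div_eq_mul_inv] using hn2.const_mul δ
  have hpow : ∀ {a : ℕ → ℝ}, Filter.Tendsto a Filter.atTop (nhds 0) →
      Filter.Tendsto (fun n => a n ^ p) Filter.atTop (nhds 0) := fun ha => by
    simpa [Real.zero_rpow hp0.ne'] using ha.rpow_const (p := p) (Or.inr hp0.le)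
  -- The decay carries `(r / 4^n)^(N + p)`, the volume of the cylinder up to `2^N`; the means are
  -- thus at most a multiple of `(δ / 2^n)^p`.
  have hzero := ae_eq_zero_of_forall_center (y := y) (s := s) (ρ := ρ) (τ := τ)
    hWm.measurable_mk (r := fun n => r / 4 ^ n) (τ' := fun n => (r / 4 ^ n) ^ p)
    (c := fun n => ENNReal.ofReal (ε * (δ / 2 ^ n) ^ p / 2 ^ N)) (fun n => by positivity) hr0
    (fun n => by positivity) (hpow hr0)
    (by
      have h := ((hpow hδ0).const_mul ε).div_const (2 ^ N)
      rw [mul_zero, zero_div] at h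
      simpa using ENNReal.tendsto_ofReal h)
    (fun n z₀ hz₀ => by
      have hsub : parabolicCylinder z₀.1 z₀.2 (r / 4 ^ n) ((r / 4 ^ n) ^ p) ⊆ E :=
        (hsubr z₀ _ (by positivity) (hrn n)).trans (subset_closure.trans (hE z₀ hz₀))
      have h := hdecay sgn u z₀.1 z₀.2 r k δ hr hδ
        (hu.1.mono_measure (Measure.restrict_mono (subset_closure.trans (hE z₀ hz₀)) le_rfl))
        (fun ρ' k' h0 h1 => hu.energyInequality_half hp0 hA h0
          ((closure_mono (hsubr z₀ ρ' h0 h1)).trans (hE z₀ hz₀)) k') (hY z₀ hz₀) n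
      refine le_trans (le_of_eq (lintegral_congr_ae
        (ae_restrict_of_ae_restrict_of_subset hsub hWm.ae_eq_mk.symm))) (h.trans_eq ?_)
      rw [← ENNReal.ofReal_pow (by positivity), ← ENNReal.ofReal_mul (by positivity),
        ← ENNReal.ofReal_mul (by positivity), Real.rpow_add (by positivity), Real.rpow_natCast]
      congr 1
      rw [mul_pow 2]
      field_simp)
  rcases (parabolicCylinder y s ρ τ).eq_empty_or_nonempty with h0 | h0
  · simp [h0]
  have hCE : parabolicCylinder y s ρ τ ⊆ E := fun z hz => hE z hz (subset_closure
    ⟨fun i => by rw [sub_self, abs_zero]; exact hr,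
      sub_lt_self _ (by positivity), le_rfl⟩)
  filter_upwards [hzero, ae_restrict_of_ae_restrict_of_subset hCE hWm.ae_eq_mk] with z h1 h2
  rw [← h2, ENNReal.rpow_eq_zero_iff_of_pos hp0, ENNReal.ofReal_eq_zero, hK,
    trunc_shiftLevel sgn _ k (by positivity)] at h1
  linarith [le_max_left (trunc sgn (u z) k - 2 * δ) 0]

/-- The essential supremum of `(u - k)_±` over `(y,s) + Q_{ρ,τ}`. -/
def truncSup {N : ℕ} (sgn : Side) (u : Space N × ℝ → ℝ) (y : Space N) (s ρ τ k : ℝ) : ENNReal :=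
  essSup (fun z => ENNReal.ofReal (trunc sgn (u z) k)) (volume.restrict (parabolicCylinder y s ρ τ))

theorem truncSup_mono {N : ℕ} (sgn : Side) (u : Space N × ℝ → ℝ) {y : Space N} {s ρ ρ' τ τ' : ℝ}
    (k : ℝ) (hρ : ρ ≤ ρ') (hτ : τ ≤ τ') :
    truncSup sgn u y s ρ τ k ≤ truncSup sgn u y s ρ' τ' k :=
  essSup_mono_measure' (Measure.restrict_mono (parabolicCylinder_subset
    (fun i => by rw [sub_self, abs_zero, zero_add]; exact hρ) (by linarith) le_rfl) le_rfl)

theorem lintegral_trunc_rpow_le {N : ℕ} (sgn : Side) {p : ℝ} (hp : 1 ≤ p) {u : Space N × ℝ → ℝ}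
    {y : Space N} {s ρ τ : ℝ} (k : ℝ)
    (hu : AEMeasurable u (volume.restrict (parabolicCylinder y s ρ τ))) :
    ∫⁻ z in parabolicCylinder y s ρ τ, ENNReal.ofReal (trunc sgn (u z) k) ^ p ≤
      truncSup sgn u y s ρ τ k ^ (p - 1) *
        ∫⁻ z in parabolicCylinder y s ρ τ, ENNReal.ofReal (trunc sgn (u z) k) := by
  have hm : AEMeasurable (fun z => ENNReal.ofReal (trunc sgn (u z) k))
      (volume.restrict (parabolicCylinder y s ρ τ)) :=
    (measurable_trunc sgn k).ennreal_ofReal.comp_aemeasurable hu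
  rw [← lintegral_const_mul'' _ hm]
  refine lintegral_mono_ae ?_
  filter_upwards [ENNReal.ae_le_essSup (fun z => ENNReal.ofReal (trunc sgn (u z) k))] with z hz
  calc ENNReal.ofReal (trunc sgn (u z) k) ^ p
      = ENNReal.ofReal (trunc sgn (u z) k) ^ (p - 1) * ENNReal.ofReal (trunc sgn (u z) k) := by
        conv_lhs => rw [← sub_add_cancel p 1]
        rw [ENNReal.rpow_add_of_nonneg _ _ (by linarith) zero_le_one, ENNReal.rpow_one]
    _ ≤ _ := by
        gcongr
        exact hz

/-- The bound of the supremum by the `p`-th power integral, for cylinders separated by `r`. -/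
theorem exists_truncSup_rpow_le (N : ℕ) {p : ℝ} (hp : 1 < p) {A₀ : ℝ → ℝ → ℝ → ℝ → ℝ}
    (hA : IsHomogeneousQuantity p A₀) :
    ∃ a : ℝ, 0 < a ∧ ∀ (sgn : Side) (E : Set (Space N × ℝ)) (u : Space N × ℝ → ℝ),
      InGeneralizedClass sgn p A₀ E u → ∀ (y : Space N) (s ρ τ ρ' τ' r k : ℝ), 0 < r →
      ρ + r ≤ ρ' → τ + r ^ p ≤ τ' → closure (parabolicCylinder y s ρ' τ') ⊆ E →
      truncSup sgn u y s ρ τ k ^ p ≤ ENNReal.ofReal (a / r ^ (N + p)) *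
        ∫⁻ z in parabolicCylinder y s ρ' τ', ENNReal.ofReal (trunc sgn (u z) k) ^ p := by
  have hp0 : 0 < p := by linarith
  obtain ⟨ε, hε, h⟩ := exists_trunc_le_of_powerMass_le N hp hA
  refine ⟨2 ^ p / ε, by positivity, fun sgn E u hu y s ρ τ ρ' τ' r k hr hρ hτ hE => ?_⟩
  set X := ∫⁻ z in parabolicCylinder y s ρ' τ', ENNReal.ofReal (trunc sgn (u z) k) ^ p with hX
  have hsub : ∀ z₀ ∈ parabolicCylinder y s ρ τ,
      parabolicCylinder z₀.1 z₀.2 r (r ^ p) ⊆ parabolicCylinder y s ρ' τ' := fun z₀ hz₀ =>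
    parabolicCylinder_subset (fun i => by linarith [show |z₀.1 i - y i| < ρ from hz₀.1 i])
      (by linarith [hz₀.2.1]) hz₀.2.2
  have hbound : ∀ δ : ℝ, 0 < δ → X ≤ ENNReal.ofReal (ε * δ ^ p * r ^ (N + p)) →
      truncSup sgn u y s ρ τ k ≤ ENNReal.ofReal (2 * δ) := fun δ hδ hXδ => by
    refine essSup_le_of_ae_le _ ?_
    filter_upwards [h sgn E u hu y s ρ τ r k δ hr hδ
      (fun z₀ hz₀ => (closure_mono (hsub z₀ hz₀)).trans hE)
      (fun z₀ hz₀ => (lintegral_mono_set (hsub z₀ hz₀)).trans hXδ)] with z hz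
    exact ENNReal.ofReal_le_ofReal hz
  by_cases hXtop : X = ⊤
  · rw [hXtop, ENNReal.mul_top (ENNReal.ofReal_pos.2 (by positivity)).ne']
    exact le_top
  have hx0 : 0 ≤ X.toReal := ENNReal.toReal_nonneg
  rw [← ENNReal.ofReal_toReal hXtop, ← ENNReal.ofReal_mul (by positivity)]
  -- For a positive integral, `δ` is chosen with equality in the smallness condition; if the
  -- integral is zero, every `δ > 0` is admissible and the supremum is zero.
  rcases hx0.eq_or_lt with hx | hx
  · have hX0 : X = 0 := by
      rw [← ENNReal.ofReal_toReal hXtop, ← hx, ENNReal.ofReal_zero]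
    have h0 : truncSup sgn u y s ρ τ k = 0 := by
      refine le_antisymm (ENNReal.le_of_forall_pos_le_add fun e he _ => ?_) zero_le
      have := hbound (e / 2) (by positivity) (by rw [hX0]; exact zero_le)
      rw [mul_div_cancel₀ _ two_ne_zero, ENNReal.ofReal_coe_nnreal] at this
      rwa [zero_add]
    rw [h0, ENNReal.zero_rpow_of_pos hp0]
    exact zero_le
  · set q : ℝ := X.toReal / (ε * r ^ (N + p)) with hq
    have hq0 : 0 < q := by positivity
    have hqp : (q ^ p⁻¹) ^ p = q := by
      rw [← Real.rpow_mul hq0.le, inv_mul_cancel₀ hp0.ne', Real.rpow_one]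
    have h1 := hbound (q ^ p⁻¹) (by positivity) (by
      rw [hqp]
      refine (ENNReal.ofReal_toReal hXtop).symm.le.trans (ENNReal.ofReal_le_ofReal (le_of_eq ?_))
      rw [hq]
      field_simp)
    refine (ENNReal.rpow_le_rpow h1 hp0.le).trans_eq ?_
    rw [ENNReal.ofReal_rpow_of_nonneg (by positivity) hp0.le,
      Real.mul_rpow (by norm_num) (by positivity), hqp]
    congr 1
    rw [hq]
    field_simp

/-! ### Reduction to the first power. -/

/-- Absorption of the powers in an infinite chain of inequalities. -/
theorem le_of_rpow_le_mul_rpow_succ {p a b I B : ℝ} (hp : 1 < p) (ha : 0 ≤ a) (hb : 1 ≤ b)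
    (hI : 0 ≤ I) {M : ℕ → ℝ} (hM : ∀ j, 0 ≤ M j) (hMB : ∀ j, M j ≤ B)
    (h : ∀ j, M j ^ p ≤ a * b ^ j * (M (j + 1) ^ (p - 1) * I)) :
    M 0 ≤ a * b ^ (p - 1) * I := by
  have hp0 : 0 < p := by linarith
  have hb0 : 0 < b := by linarith
  set D := a * b ^ (p - 1) * I with hD
  have hD0 : 0 ≤ D := by positivity
  have hbdd : BddAbove (range fun j => M j / b ^ j) :=
    ⟨B, by
      rintro _ ⟨j, rfl⟩
      exact (div_le_self (hM j) (one_le_pow₀ hb)).trans (hMB j)⟩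
  -- The weight `b^{-j}` compensates the growth of the constants: the whole chain reduces to `S^p ≤
  -- D S^(p-1)`. Division by `S^(p-1)` is legitimate because the uniform bound makes `S` finite.
  set S := ⨆ j, M j / b ^ j with hS
  have hle : ∀ j, M j / b ^ j ≤ S := le_ciSup hbdd
  have hM0 : M 0 ≤ S := by simpa using hle 0
  have hS0 : 0 ≤ S := (hM 0).trans hM0
  have hpow : ∀ j, (M j / b ^ j) ^ p ≤ D * S ^ (p - 1) := fun j => by
    have hbj : 0 < b ^ j := by positivity
    have h1 : M (j + 1) ≤ S * (b ^ j * b) := by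
      have := hle (j + 1)
      rwa [div_le_iff₀ (by positivity), pow_succ] at this
    rw [Real.div_rpow (hM j) hbj.le, div_le_iff₀ (by positivity)]
    calc M j ^ p ≤ a * b ^ j * (M (j + 1) ^ (p - 1) * I) := h j
      _ ≤ a * b ^ j * ((S * (b ^ j * b)) ^ (p - 1) * I) := by
          gcongr
          exact hM _
      _ = D * S ^ (p - 1) * (b ^ j) ^ p := by
          have e : (b ^ j) ^ p = (b ^ j) ^ (p - 1) * b ^ j := by
            conv_lhs => rw [← sub_add_cancel p 1]
            rw [Real.rpow_add hbj, Real.rpow_one]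
          rw [Real.mul_rpow hS0 (by positivity), Real.mul_rpow hbj.le hb0.le, e, hD]
          ring
  have hSle : S ≤ (D * S ^ (p - 1)) ^ p⁻¹ := ciSup_le fun j =>
    (Real.le_rpow_inv_iff_of_pos (div_nonneg (hM j) (by positivity)) (by positivity) hp0).2 (hpow j)
  have hSp : S ^ p ≤ D * S ^ (p - 1) :=
    (Real.le_rpow_inv_iff_of_pos hS0 (by positivity) hp0).1 hSle
  rcases hS0.eq_or_lt with h0 | h0
  · linarith
  · have e : S ^ p = S * S ^ (p - 1) := by
      conv_lhs => rw [← sub_add_cancel p 1]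
      rw [Real.rpow_add h0, Real.rpow_one, mul_comm]
    rw [e] at hSp
    exact hM0.trans (le_of_mul_le_mul_right hSp (by positivity))

theorem InParabolicSpace.lintegral_trunc_rpow_lt_top {N : ℕ} {p : ℝ} (hp : 1 ≤ p) {y : Space N}
    {s R T : ℝ} {u : Space N × ℝ → ℝ} (hu : InParabolicSpace p y s R T u) (sgn : Side) (k : ℝ) :
    ∫⁻ z in parabolicCylinder y s R T, ENNReal.ofReal (trunc sgn (u z) k) ^ p < ⊤ := by
  have hp0 : 0 < p := by linarith
  have hfin : IsFiniteMeasure (volume.restrict (parabolicCylinder y s R T)) := ⟨by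
    rw [Measure.restrict_apply_univ, volume_parabolicCylinder]
    exact ENNReal.mul_lt_top (ENNReal.pow_lt_top ENNReal.ofReal_lt_top) ENNReal.ofReal_lt_top⟩
  have hm : MemLp (fun z => trunc sgn (u z) k) (ENNReal.ofReal p)
      (volume.restrict (parabolicCylinder y s R T)) := by
    refine (hu.2.1.norm.add (memLp_const |k|)).mono
      ((measurable_trunc sgn k).comp_aemeasurable hu.2.1.1.aemeasurable).aestronglyMeasurable
      (.of_forall fun z => ?_)
    simp only [Pi.add_apply]
    rw [Real.norm_of_nonneg (trunc_nonneg _ _ _), Real.norm_of_nonneg (by positivity)]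
    exact trunc_le sgn _ k
  have h := lintegral_rpow_enorm_lt_top_of_eLpNorm_lt_top (ENNReal.ofReal_pos.2 hp0).ne'
    ENNReal.ofReal_ne_top hm.2
  simpa only [ENNReal.toReal_ofReal hp0.le, Real.enorm_of_nonneg (trunc_nonneg _ _ _)] using h

/-- The largest radius used in the passage from `Q_{ρ,τ}` to `Q_{R,T}`. -/
def gapRadius (p R T ρ τ : ℝ) : ℝ := min (R - ρ) ((T - τ) ^ p⁻¹) / 4

theorem gapRadius_pos {p R T ρ τ : ℝ} (hρ : ρ < R) (hτ : τ < T) : 0 < gapRadius p R T ρ τ := by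
  have h1 : 0 < R - ρ := by linarith
  have h2 : 0 < T - τ := by linarith
  exact div_pos (lt_min h1 (by positivity)) (by norm_num)

theorem gapRadius_le {p R T ρ τ : ℝ} : 4 * gapRadius p R T ρ τ ≤ R - ρ := by
  rw [gapRadius, mul_div_cancel₀ _ four_ne_zero]
  exact min_le_left _ _

theorem gapRadius_rpow_le {p R T ρ τ : ℝ} (hp : 1 < p) (hρ : ρ < R) (hτ : τ < T) :
    4 * gapRadius p R T ρ τ ^ p ≤ T - τ := by
  have h0 := gapRadius_pos (p := p) hρ hτ
  have hp0 : 0 < p := by linarith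
  have h2 : 0 < T - τ := by linarith
  calc 4 * gapRadius p R T ρ τ ^ p ≤ 4 ^ p * gapRadius p R T ρ τ ^ p := by
        gcongr
        exact Real.self_le_rpow_of_one_le (by norm_num) hp.le
    _ = (4 * gapRadius p R T ρ τ) ^ p := (Real.mul_rpow (by norm_num) h0.le).symm
    _ ≤ ((T - τ) ^ p⁻¹) ^ p := by
        gcongr
        rw [gapRadius, mul_div_cancel₀ _ four_ne_zero]
        exact min_le_right _ _
    _ = T - τ := by rw [← Real.rpow_mul h2.le, inv_mul_cancel₀ hp0.ne', Real.rpow_one]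

/-- The bound of the supremum by the integral of the first power. -/
theorem exists_truncSup_le (N : ℕ) {p : ℝ} (hp : 1 < p) {A₀ : ℝ → ℝ → ℝ → ℝ → ℝ}
    (hA : IsHomogeneousQuantity p A₀) :
    ∃ C : ℝ, 0 < C ∧ ∀ (sgn : Side) (E : Set (Space N × ℝ)) (u : Space N × ℝ → ℝ),
      InGeneralizedClass sgn p A₀ E u → ∀ (y : Space N) (s R T ρ τ k : ℝ),
      0 < ρ → ρ < R → 0 < τ → τ < T → parabolicCylinder y s R T ⊆ E →
      truncSup sgn u y s ρ τ k ≤ ENNReal.ofReal (C / gapRadius p R T ρ τ ^ (N + p)) *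
        ∫⁻ z in parabolicCylinder y s R T, ENNReal.ofReal (trunc sgn (u z) k) := by
  have hp0 : 0 < p := by linarith
  obtain ⟨a, ha, hsup⟩ := exists_truncSup_rpow_le N hp hA
  refine ⟨a * (2 ^ (N + p)) ^ (p - 1), by positivity,
    fun sgn E u hu y s R T ρ τ k hρ hρR hτ hτT hE => ?_⟩
  set r := gapRadius p R T ρ τ with hr
  have hr0 : 0 < r := gapRadius_pos hρR hτT
  have hrR : 4 * r ≤ R - ρ := gapRadius_le
  have hrT : 4 * r ^ p ≤ T - τ := gapRadius_rpow_le hp hρR hτT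
  have hrp : 0 < r ^ p := by positivity
  set I := ∫⁻ z in parabolicCylinder y s R T, ENNReal.ofReal (trunc sgn (u z) k) with hI
  by_cases hItop : I = ⊤
  · rw [hItop, ENNReal.mul_top (ENNReal.ofReal_pos.2 (by positivity)).ne']
    exact le_top
  have hcl : ∀ ρ' τ' : ℝ, ρ' < R → τ' < T → closure (parabolicCylinder y s ρ' τ') ⊆ E :=
    fun ρ' τ' h1 h2 => (closure_parabolicCylinder_subset_parabolicCylinder
      (fun i => by rw [sub_self, abs_zero, zero_add]; exact h1) (by linarith) le_rfl).trans hE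
  -- Of the four gaps `r` available, the chain uses two, the proof that the suprema are finite a
  -- third, and the last keeps the closures inside `E`.
  set ρs : ℕ → ℝ := fun j => ρ + 2 * r * (1 - (1 / 2) ^ j) with hρs
  set τs : ℕ → ℝ := fun j => τ + 2 * r ^ p * (1 - (1 / 2) ^ j) with hτs
  have hhalf : ∀ j : ℕ, (0 : ℝ) < (1 / 2) ^ j := fun j => by positivity
  have hρs_le : ∀ j, ρs j ≤ ρ + 2 * r := fun j => by
    simp only [hρs]
    nlinarith [hhalf j]
  have hτs_le : ∀ j, τs j ≤ τ + 2 * r ^ p := fun j => by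
    simp only [hτs]
    nlinarith [hhalf j]
  set B := truncSup sgn u y s (ρ + 2 * r) (τ + 2 * r ^ p) k with hB
  -- Finiteness must precede absorption; it comes from the `p`-th power bound and the `L^p`
  -- membership of `u` on compactly contained cylinders.
  have hBtop : B ≠ ⊤ := fun hBt => by
    have h1 := hsup sgn E u hu y s (ρ + 2 * r) (τ + 2 * r ^ p) (ρ + 3 * r) (τ + 3 * r ^ p) r k hr0
      (by linarith) (by linarith) (hcl _ _ (by linarith) (by linarith))
    have h2 := (hu.2 y s (ρ + 3 * r) (τ + 3 * r ^ p) (by linarith) (by linarith)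
      (hcl _ _ (by linarith) (by linarith))).1.lintegral_trunc_rpow_lt_top hp.le sgn k
    rw [← hB, hBt, ENNReal.top_rpow_of_pos hp0] at h1
    exact (h1.trans_lt (ENNReal.mul_lt_top ENNReal.ofReal_lt_top h2)).ne rfl
  set M : ℕ → ENNReal := fun j => truncSup sgn u y s (ρs j) (τs j) k with hM
  have hMB : ∀ j, M j ≤ B := fun j => truncSup_mono sgn u k (hρs_le j) (hτs_le j)
  have hMtop : ∀ j, M j ≠ ⊤ := fun j => ne_top_of_le_ne_top hBtop (hMB j)
  have hstep : ∀ j, M j ^ p ≤ ENNReal.ofReal (a / r ^ (N + p) * (2 ^ (N + p)) ^ j) *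
      (M (j + 1) ^ (p - 1) * I) := fun j => by
    -- Since `p ≥ 1`, the time increment `r^p 2^{-j}` is large enough for the radius increment `r
    -- 2^{-j}`.
    have hrj : (r * (1 / 2) ^ j) ^ p ≤ r ^ p * (1 / 2) ^ j := by
      rw [Real.mul_rpow hr0.le (hhalf j).le]
      refine mul_le_mul_of_nonneg_left ?_ hrp.le
      exact Real.rpow_le_self_of_le_one (hhalf j).le
        (pow_le_one₀ (by norm_num) (by norm_num)) hp.le
    have hlt1 : ρs (j + 1) < R := (hρs_le _).trans_lt (by linarith)
    have hlt2 : τs (j + 1) < T := (hτs_le _).trans_lt (by linarith)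
    have hsub : parabolicCylinder y s (ρs (j + 1)) (τs (j + 1)) ⊆ parabolicCylinder y s R T :=
      parabolicCylinder_subset (fun i => by rw [sub_self, abs_zero, zero_add]; exact hlt1.le)
        (by linarith) le_rfl
    have h1 := hsup sgn E u hu y s (ρs j) (τs j) (ρs (j + 1)) (τs (j + 1)) (r * (1 / 2) ^ j) k
      (by positivity) (le_of_eq (by simp only [hρs, pow_succ]; ring))
      (by
        refine (add_le_add_right hrj _).trans_eq ?_
        simp only [hτs, pow_succ]
        ring) (hcl _ _ hlt1 hlt2)
    refine h1.trans (mul_le_mul' (ENNReal.ofReal_le_ofReal (le_of_eq ?_))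
      ((lintegral_trunc_rpow_le sgn hp.le k (hu.1.mono_measure
        (Measure.restrict_mono (hsub.trans hE) le_rfl))).trans
        (mul_le_mul' le_rfl (lintegral_mono_set hsub))))
    rw [Real.mul_rpow hr0.le (hhalf j).le, ← Real.rpow_natCast, ← Real.rpow_natCast,
      ← Real.rpow_mul (by norm_num), ← Real.rpow_mul (by norm_num), mul_comm (j : ℝ),
      one_div, Real.inv_rpow (by norm_num)]
    field_simp
  have hreal := le_of_rpow_le_mul_rpow_succ hp (a := a / r ^ (N + p)) (b := 2 ^ (N + p))
    (I := I.toReal) (B := B.toReal) (M := fun j => (M j).toReal) (by positivity)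
    (Real.one_le_rpow (by norm_num) (by positivity)) ENNReal.toReal_nonneg
    (fun j => ENNReal.toReal_nonneg) (fun j => ENNReal.toReal_mono hBtop (hMB j))
    (fun j => by
      have h1 := ENNReal.toReal_mono (ENNReal.mul_ne_top ENNReal.ofReal_ne_top (ENNReal.mul_ne_top
        (ENNReal.rpow_ne_top_of_nonneg (by linarith) (hMtop (j + 1))) hItop)) (hstep j)
      rwa [ENNReal.toReal_mul, ENNReal.toReal_mul, ← ENNReal.toReal_rpow, ← ENNReal.toReal_rpow,
        ENNReal.toReal_ofReal (by positivity)] at h1)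
  have h0 : truncSup sgn u y s ρ τ k = M 0 := by simp [hM, hρs, hτs]
  rw [h0, ← ENNReal.ofReal_toReal (hMtop 0), ← ENNReal.ofReal_toReal hItop,
    ← ENNReal.ofReal_mul (by positivity)]
  refine ENNReal.ofReal_le_ofReal (hreal.trans_eq ?_)
  ring

/-- The quantity is the constant already found, multiplied by the normalization of the estimate. It
is homogeneous because, for `T = R^p`, the gap radius scales like `R`, and both `(R - ρ)^N (T - τ)`
and the gap radius to the power `N + p` scale like `R^(N+p)`. -/
theorem exists_supEstimate (N : ℕ) {p : ℝ} (hp : 1 < p) {A₀ : ℝ → ℝ → ℝ → ℝ → ℝ}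
    (hA : IsHomogeneousQuantity p A₀) :
    ∃ A : ℝ → ℝ → ℝ → ℝ → ℝ, IsHomogeneousQuantity p A ∧
      ∀ (sgn : Side) (E : Set (Space N × ℝ)) (u : Space N × ℝ → ℝ),
        InGeneralizedClass sgn p A₀ E u → SupEstimate sgn A E u := by
  obtain ⟨C, hC, h⟩ := exists_truncSup_le N hp hA
  have hp0 : 0 < p := by linarith
  refine ⟨fun R T ρ τ => C / gapRadius p R T ρ τ ^ (N + p) * ((R - ρ) ^ N * (T - τ)), ⟨?_, ?_⟩, ?_⟩
  · intro R T ρ τ _ hρ _ hτ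
    have h1 := gapRadius_pos (p := p) hρ hτ
    have h2 : 0 < R - ρ := by linarith
    have h3 : 0 < T - τ := by linarith
    positivity
  · refine ⟨fun σ₁ σ₂ => C / gapRadius p 1 1 σ₁ σ₂ ^ (N + p) * ((1 - σ₁) ^ N * (1 - σ₂)),
      fun R σ₁ σ₂ hR _ h1 _ h2 => ?_⟩
    have h1' : 0 < 1 - σ₁ := by linarith
    have h2' : 0 < 1 - σ₂ := by linarith
    have e : gapRadius p R (R ^ p) (σ₁ * R) (σ₂ * R ^ p) = gapRadius p 1 1 σ₁ σ₂ * R := by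
      rw [gapRadius, gapRadius, show R ^ p - σ₂ * R ^ p = (1 - σ₂) * R ^ p by ring,
        Real.mul_rpow h2'.le (by positivity), ← Real.rpow_mul hR.le, mul_inv_cancel₀ hp0.ne',
        Real.rpow_one, show R - σ₁ * R = (1 - σ₁) * R by ring, ← min_mul_of_nonneg _ _ hR.le]
      ring
    have h0 := gapRadius_pos (p := p) h1 h2
    simp only
    rw [e, Real.mul_rpow h0.le hR.le, Real.rpow_add hR, Real.rpow_natCast,
      show R ^ p - σ₂ * R ^ p = (1 - σ₂) * R ^ p by ring,
      show R - σ₁ * R = (1 - σ₁) * R by ring, mul_pow]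
    field_simp
  · intro sgn E u hu y s R T ρ τ k hρ hρR hτ hτT hE
    have h2 : 0 < R - ρ := by linarith
    have h3 : 0 < T - τ := by linarith
    simp only
    rw [mul_div_cancel_right₀ _ (by positivity)]
    exact h sgn E u hu y s R T ρ τ k hρ hρR hτ hτT hE

/-! ### Boundedness on compact sets. -/

/-- The top is raised by `τ/2`, since a cylinder is not a neighbourhood of a point of its top face.
-/
theorem parabolicCylinder_mem_nhds {N : ℕ} {z : Space N × ℝ} {ρ τ : ℝ} (hρ : 0 < ρ) (hτ : 0 < τ) :
    parabolicCylinder z.1 (z.2 + τ / 2) ρ τ ∈ nhds z := by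
  have h : cube z.1 ρ ×ˢ Ioo (z.2 + τ / 2 - τ) (z.2 + τ / 2) ∈ nhds z :=
    ((isOpen_cube _ _).prod isOpen_Ioo).mem_nhds
      ⟨fun i => by rw [sub_self, abs_zero]; exact hρ, by linarith, by linarith⟩
  exact Filter.mem_of_superset h (prod_mono Subset.rfl Ioo_subset_Ioc_self)

theorem exists_closure_parabolicCylinder_subset {N : ℕ} {E : Set (Space N × ℝ)} (hE : IsOpen E)
    {z : Space N × ℝ} (hz : z ∈ E) :
    ∃ r : ℝ, 0 < r ∧ ∀ ρ τ σ : ℝ, ρ ≤ r → τ ≤ r → |σ| ≤ r →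
      closure (parabolicCylinder z.1 (z.2 + σ) ρ τ) ⊆ E := by
  obtain ⟨e, he, hball⟩ := Metric.isOpen_iff.1 hE z hz
  -- The space displacement has norm at most `2r√N` and the time displacement is at most `2r`; both
  -- are less than `e` for this `r`.
  refine ⟨e / (2 * (Real.sqrt N + 2)), by positivity, fun ρ τ σ hρ hτ hσ => ?_⟩
  set r := e / (2 * (Real.sqrt N + 2)) with hr
  have hr0 : 0 < r := by positivity
  have her : e = 2 * (Real.sqrt N + 2) * r := by rw [hr]; field_simp
  have hs : 0 ≤ Real.sqrt N := Real.sqrt_nonneg _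
  refine (closure_parabolicCylinder_subset _ _ _ _).trans (Subset.trans ?_ hball)
  rintro ⟨x, t⟩ ⟨hx, ht⟩
  rw [abs_le] at hσ
  rw [Metric.mem_ball, Prod.dist_eq]
  refine max_lt ?_ ?_
  · have h1 : x - z.1 ∈ cube (0 : Space N) (2 * r) := fun i => by
      have : |x i - z.1 i| ≤ ρ := hx i
      simp only [PiLp.sub_apply, PiLp.zero_apply, sub_zero]
      linarith
    have h2 := enorm_le_of_mem_cube h1
    rw [← ofReal_norm, ENNReal.ofReal_le_ofReal_iff (by positivity)] at h2
    change dist x z.1 < e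
    rw [dist_eq_norm]
    nlinarith
  · rw [Real.dist_eq, abs_lt]
    have h1 := ht.1
    have h2 := ht.2
    simp only at h1 h2
    constructor <;> nlinarith

theorem SupEstimate.locallyBoundedSide {N : ℕ} {p : ℝ} (hp : 1 ≤ p) {sgn : Side}
    {A A₀ : ℝ → ℝ → ℝ → ℝ → ℝ} {E : Set (Space N × ℝ)} (hE : IsOpen E) {u : Space N × ℝ → ℝ}
    (hu : InGeneralizedClass sgn p A₀ E u) (h : SupEstimate sgn A E u) :
    LocallyBoundedSide sgn E u := by
  intro K hK hKE
  refine hK.induction_on (p := fun K => ∃ M : ℝ, ∀ᵐ z ∂(volume.restrict K), trunc sgn (u z) 0 ≤ M)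
    ⟨0, by simp⟩ ?_ ?_ ?_
  · rintro K₁ K₂ h12 ⟨M, hM⟩
    exact ⟨M, ae_restrict_of_ae_restrict_of_subset h12 hM⟩
  · rintro K₁ K₂ ⟨M₁, h1⟩ ⟨M₂, h2⟩
    refine ⟨max M₁ M₂, (ae_restrict_union_iff _ _ _).2 ⟨?_, ?_⟩⟩
    · exact h1.mono fun z hz => hz.trans (le_max_left _ _)
    · exact h2.mono fun z hz => hz.trans (le_max_right _ _)
  · intro z hz
    obtain ⟨r, hr, hsub⟩ := exists_closure_parabolicCylinder_subset hE (hKE hz)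
    have hcl := hsub r r (r / 2 / 2) le_rfl le_rfl (by rw [abs_of_pos (by positivity)]; linarith)
    refine ⟨_, mem_nhdsWithin_of_mem_nhds
      (parabolicCylinder_mem_nhds (ρ := r / 2) (τ := r / 2) (by positivity) (by positivity)), ?_⟩
    have hest := h z.1 (z.2 + r / 2 / 2) r r (r / 2) (r / 2) 0 (by positivity) (by linarith)
      (by positivity) (by linarith) (subset_closure.trans hcl)
    have hpow := ((hu.2 _ _ _ _ hr hr hcl).1).lintegral_trunc_rpow_lt_top hp sgn 0
    -- On a set of finite measure, `w ≤ 1 + w^p` turns `p`-integrability into integrability, so the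
    -- right-hand side of the estimate is finite.
    have hfin : ∫⁻ w in parabolicCylinder z.1 (z.2 + r / 2 / 2) r r,
        ENNReal.ofReal (trunc sgn (u w) 0) < ⊤ := by
      refine (lintegral_mono (g := fun w => 1 + ENNReal.ofReal (trunc sgn (u w) 0) ^ p)
        fun w => ?_).trans_lt ?_
      · rcases le_total (ENNReal.ofReal (trunc sgn (u w) 0)) 1 with h1 | h1
        · exact h1.trans le_self_add
        · exact (ENNReal.le_rpow_self_of_one_le h1 hp).trans le_add_self
      · rw [lintegral_add_left measurable_const, setLIntegral_const, one_mul,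
          volume_parabolicCylinder]
        exact ENNReal.add_lt_top.2 ⟨ENNReal.mul_lt_top (ENNReal.pow_lt_top ENNReal.ofReal_lt_top)
          ENNReal.ofReal_lt_top, hpow⟩
    have htop := hest.trans_lt (ENNReal.mul_lt_top ENNReal.ofReal_lt_top hfin)
    refine ⟨(truncSup sgn u z.1 (z.2 + r / 2 / 2) (r / 2) (r / 2) 0).toReal, ?_⟩
    filter_upwards [ENNReal.ae_le_essSup (fun w => ENNReal.ofReal (trunc sgn (u w) 0))] with w hw
    exact (ENNReal.ofReal_le_iff_le_toReal htop.ne).1 hw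

end ParabolicDeGiorgi
end

theorem theorem2p1 (N : ℕ) (hN : 1 ≤ N) (p : ℝ) (hp : 1 < p) :
    (∀ γ : ℝ, 0 < γ →
      ∃ A : ℝ → ℝ → ℝ → ℝ → ℝ, ParabolicDeGiorgi.IsHomogeneousQuantity p A ∧
        ∀ (sgn : ParabolicDeGiorgi.Side) (E : Set (ParabolicDeGiorgi.Space N × ℝ))
          (u : ParabolicDeGiorgi.Space N × ℝ → ℝ), IsOpen E →
          ParabolicDeGiorgi.InDeGiorgiClass sgn p γ E u →
            ParabolicDeGiorgi.SupEstimate sgn A E u ∧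
              ParabolicDeGiorgi.LocallyBoundedSide sgn E u) ∧
    (∀ A₀ : ℝ → ℝ → ℝ → ℝ → ℝ, ParabolicDeGiorgi.IsHomogeneousQuantity p A₀ →
      ∃ A : ℝ → ℝ → ℝ → ℝ → ℝ, ParabolicDeGiorgi.IsHomogeneousQuantity p A ∧
        ∀ (sgn : ParabolicDeGiorgi.Side) (E : Set (ParabolicDeGiorgi.Space N × ℝ))
          (u : ParabolicDeGiorgi.Space N × ℝ → ℝ), IsOpen E →
          ParabolicDeGiorgi.InGeneralizedClass sgn p A₀ E u →
            ParabolicDeGiorgi.SupEstimate sgn A E u ∧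
              ParabolicDeGiorgi.LocallyBoundedSide sgn E u) := by
  have main : ∀ A₀ : ℝ → ℝ → ℝ → ℝ → ℝ, ParabolicDeGiorgi.IsHomogeneousQuantity p A₀ →
      ∃ A : ℝ → ℝ → ℝ → ℝ → ℝ, ParabolicDeGiorgi.IsHomogeneousQuantity p A ∧
        ∀ (sgn : ParabolicDeGiorgi.Side) (E : Set (ParabolicDeGiorgi.Space N × ℝ))
          (u : ParabolicDeGiorgi.Space N × ℝ → ℝ), IsOpen E →
          ParabolicDeGiorgi.InGeneralizedClass sgn p A₀ E u →
            ParabolicDeGiorgi.SupEstimate sgn A E u ∧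
              ParabolicDeGiorgi.LocallyBoundedSide sgn E u := fun A₀ hA₀ => by
    obtain ⟨A, hA, h⟩ := ParabolicDeGiorgi.exists_supEstimate N hp hA₀
    exact ⟨A, hA, fun sgn E u hE hu => ⟨h sgn E u hu, (h sgn E u hu).locallyBoundedSide hp.le hE hu⟩⟩
  -- A constant is a homogeneous quantity, with `f` constant.
  exact ⟨fun γ hγ => main _ ⟨fun _ _ _ _ _ _ _ _ => hγ, fun _ _ => γ, fun _ _ _ _ _ _ _ _ => rfl⟩,
    main⟩
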